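/- Let $F$ be a field of characteristic $0$ and $G$ a group. Let $R_{FG}$ be the Green ring of $FG$: the abelian group generated by the isomorphism classes of finite-dimensional $FG$-modules subject to $[U\oplus V]=[U]+[V]$, with multiplication given by tensor products over $F$. Put $\Gamma=\mathbb Q\otimes_{\mathbb Z}R_{FG}$ and $\Pi=\Gamma[[t]]$, and write $t\Pi$ and $1+t\Pi$ for the sets of power series with constant term $0$ and $1$ respectively. For a finite-dimensional $FG$-module $V$ write $V$ also for its class in $\Gamma$. Let $S^r(V)$ be the $r$th symmetric power of $V$, and let $L^r(V)$ be the $r$th Lie power, that is, the intersection of the homogeneous component $T^r(V)$ of the tensor algebra $T(V)$ with the Lie subalgebra of $T(V)$ generated by $V$ (a free Lie algebra on $V$). Then the following hold. (a) There is a unique $\mathbb Q$-linear map $\psi:\Gamma\to t\Pi$ such that $\psi(V)=\log\bigl(1+S^1(V)t+S^2(V)t^2+\cdots\bigr)$ for every finite-dimensional $FG$-module $V$. (b) There is a unique function $\mathcal L:t\Pi\to t\Pi$ (the Lie module function) such that $\mathcal L(Vt^r)=L^1(V)t^r+L^2(V)t^{2r}+\cdots$ for every finite-dimensional $FG$-module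 $V$ and every $r\ge 1$, $\mathcal L(f)+\mathcal L(g)=\mathcal L(f+g-fg)$ for all $f,g\in t\Pi$, and $\mathcal L(t^n\Pi\cap t\Pi)\subseteq t^n\Pi$ for all $n\ge 0$. (c) Define $\mathbf S^*:t\Pi\to 1+t\Pi$ by $\mathbf S^*(A_1t+A_2t^2+\cdots)=\exp\bigl(\sum_{i\ge1}\psi(A_i)_{t\mapsto t^i}\bigr)$, where $t\mapsto t^i$ denotes the substitution of $t^i$ for $t$, and $\mathbf L^*:1+t\Pi\to t\Pi$ by $\mathbf L^*(f)=-\mathcal L(1-f)$. Then $\mathbf L^*\circ\mathbf S^*$ is the identity function on $t\Pi$ and $\mathbf S^*\circ\mathbf L^*$ is the identity function on $1+t\Pi$; thus $\mathbf L^*$ and $\mathbf S^*$ are mutually inverse. -/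

import Mathlib

open scoped TensorProduct PowerSeries

universe u v

namespace GreenRingLie

/-! ### Finite-dimensional modules for a group over a field -/

/-- A finite-dimensional `FG`-module, given as a representation of `G` over `F`. Every
finite-dimensional `FG`-module is isomorphic to one whose carrier lies in the universe of `F`. -/
structure FinMod (F : Type u) [Field F] (G : Type v) [Group G] where
  carrier : Type u
  [addCommGroup : AddCommGroup carrier]
  [module : Module F carrier]
  [finite : FiniteDimensional F carrier]
  ρ : Representation F G carrier

attribute [instance] FinMod.addCommGroup FinMod.module FinMod.finite

variable (F : Type u) [Field F] (G : Type v) [Group G]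

/-- Isomorphism of `FG`-modules. -/
instance FinMod.setoid : Setoid (FinMod F G) where
  r U V := Nonempty (U.ρ.Equiv V.ρ)
  iseqv :=
    { refl := fun U => ⟨.refl U.ρ⟩
      symm := fun ⟨e⟩ => ⟨e.symm⟩
      trans := fun ⟨e⟩ ⟨f⟩ => ⟨e.trans f⟩ }

/-- Isomorphism classes of finite-dimensional `FG`-modules. -/
def IsoClass : Type (max (u + 1) v) := Quotient (FinMod.setoid F G)

variable {F G}

/-- The isomorphism class of a module. -/
def FinMod.isoClass (V : FinMod F G) : IsoClass F G := Quotient.mk _ V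

/-- Direct sum of modules. -/
noncomputable def FinMod.sum (U V : FinMod F G) : FinMod F G where
  carrier := U.carrier × V.carrier
  ρ := U.ρ.prod V.ρ

/-- Tensor product of modules, with the diagonal action of `G`. -/
noncomputable def FinMod.tensor (U V : FinMod F G) : FinMod F G where
  carrier := U.carrier ⊗[F] V.carrier
  ρ := U.ρ.tprod V.ρ

/-- The one-dimensional trivial module. -/
def FinMod.triv : FinMod F G where
  carrier := F
  ρ := Representation.trivial F G F

/-- Isomorphism classes form a commutative monoid under the tensor product. -/
noncomputable instance : CommMonoid (IsoClass F G) where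
  mul := Quotient.map₂ FinMod.tensor (by
    rintro U U' ⟨e⟩ V V' ⟨f⟩
    exact ⟨.mk (TensorProduct.congr e.toLinearEquiv f.toLinearEquiv) fun g => by
      apply TensorProduct.ext'
      intro x y
      exact congrArg₂ (fun a b => a ⊗ₜ[F] b)
        (Representation.IntertwiningMap.isIntertwining _ _ e.toIntertwiningMap g x)
        (Representation.IntertwiningMap.isIntertwining _ _ f.toIntertwiningMap g y)⟩)
  one := FinMod.triv.isoClass
  mul_assoc := by
    rintro ⟨U⟩ ⟨V⟩ ⟨W⟩
    exact Quotient.sound ⟨.mk (TensorProduct.assoc F _ _ _) fun g => by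
      apply TensorProduct.ext_threefold
      intro x y z
      rfl⟩
  mul_comm := by
    rintro ⟨U⟩ ⟨V⟩
    exact Quotient.sound ⟨.mk (TensorProduct.comm F _ _) fun g => by
      apply TensorProduct.ext'
      intro x y
      rfl⟩
  one_mul := by
    rintro ⟨U⟩
    exact Quotient.sound ⟨.mk (TensorProduct.lid F _) fun g => by
      apply TensorProduct.ext'
      intro a x
      exact ((U.ρ g).map_smul a x).symm⟩
  mul_one := by
    rintro ⟨U⟩
    exact Quotient.sound ⟨.mk (TensorProduct.rid F _) fun g => by
      apply TensorProduct.ext'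
      intro x a
      exact ((U.ρ g).map_smul a x).symm⟩

/-! ### Symmetric powers -/

/-- The action of `G` on the symmetric algebra `S(V)` by algebra automorphisms. -/
noncomputable def FinMod.symAction (V : FinMod F G) :
    Representation F G (SymmetricAlgebra F V.carrier) where
  toFun g := (SymmetricAlgebra.lift (SymmetricAlgebra.ι F V.carrier ∘ₗ V.ρ g)).toLinearMap
  map_one' := by
    have : SymmetricAlgebra.lift (SymmetricAlgebra.ι F V.carrier ∘ₗ V.ρ 1) =
        AlgHom.id F (SymmetricAlgebra F V.carrier) := by
      apply SymmetricAlgebra.algHom_ext; ext x; simp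
    rw [this]; rfl
  map_mul' g h := by
    have : SymmetricAlgebra.lift (SymmetricAlgebra.ι F V.carrier ∘ₗ V.ρ (g * h)) =
        (SymmetricAlgebra.lift (SymmetricAlgebra.ι F V.carrier ∘ₗ V.ρ g)).comp
          (SymmetricAlgebra.lift (SymmetricAlgebra.ι F V.carrier ∘ₗ V.ρ h)) := by
      apply SymmetricAlgebra.algHom_ext; ext x; simp
    rw [this]; rfl

/-- The `r`-th homogeneous component of `S(V)`: the span of the products of `r` elements
of `V`. -/
noncomputable def FinMod.symComponent (V : FinMod F G) (r : ℕ) :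
    Submodule F (SymmetricAlgebra F V.carrier) :=
  LinearMap.range (SymmetricAlgebra.ι F V.carrier) ^ r

theorem FinMod.symComponent_le_comap (V : FinMod F G) (r : ℕ) (g : G) :
    V.symComponent r ≤ (V.symComponent r).comap (V.symAction g) := by
  rw [← Submodule.map_le_iff_le_comap]
  change Submodule.map (SymmetricAlgebra.lift
    (SymmetricAlgebra.ι F V.carrier ∘ₗ V.ρ g)).toLinearMap (_ ^ r) ≤ _ ^ r
  rw [Submodule.map_pow]
  refine pow_le_pow_left' ?_ r
  rintro _ ⟨_, ⟨x, rfl⟩, rfl⟩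
  exact ⟨V.ρ g x, by simp⟩

/-- The symmetric power `S^r(V)`. -/
noncomputable def FinMod.symPow (V : FinMod F G) (r : ℕ) : FinMod F G where
  carrier := V.symComponent r
  finite := .of_fg (by
    rw [FinMod.symComponent, LinearMap.range_eq_map]
    exact (Module.Finite.fg_top.map (SymmetricAlgebra.ι F V.carrier)).pow r)
  ρ := V.symAction.subrepresentation (V.symComponent r) (V.symComponent_le_comap r)

/-! ### Lie powers -/

/-- The action of `G` on the tensor algebra `T(V)` by algebra automorphisms. -/
noncomputable def FinMod.tensorAction (V : FinMod F G) :
    Representation F G (TensorAlgebra F V.carrier) where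
  toFun g := (TensorAlgebra.lift F (TensorAlgebra.ι F ∘ₗ V.ρ g)).toLinearMap
  map_one' := by
    have : TensorAlgebra.lift F (TensorAlgebra.ι F ∘ₗ V.ρ 1) =
        AlgHom.id F (TensorAlgebra F V.carrier) := by
      ext x; simp
    rw [this]; rfl
  map_mul' g h := by
    have : TensorAlgebra.lift F (TensorAlgebra.ι F ∘ₗ V.ρ (g * h)) =
        (TensorAlgebra.lift F (TensorAlgebra.ι F ∘ₗ V.ρ g)).comp
          (TensorAlgebra.lift F (TensorAlgebra.ι F ∘ₗ V.ρ h)) := by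
      ext x; simp
    rw [this]; rfl

attribute [local instance] LieRing.ofAssociativeRing

/-- `L(V)`: the Lie subalgebra of `T(V)` (with bracket `[a, b] = ab - ba`) generated by `V`. -/
noncomputable def FinMod.freeLie (V : FinMod F G) :
    LieSubalgebra F (TensorAlgebra F V.carrier) :=
  LieSubalgebra.lieSpan F _ (Set.range (TensorAlgebra.ι F : V.carrier →ₗ[F] _))

/-- `T^r(V) ∩ L(V)`, where `T^r(V)` is the span of the products of `r` elements of `V`. -/
noncomputable def FinMod.lieComponent (V : FinMod F G) (r : ℕ) :
    Submodule F (TensorAlgebra F V.carrier) :=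
  LinearMap.range (TensorAlgebra.ι F : V.carrier →ₗ[F] _) ^ r ⊓ V.freeLie.toSubmodule

theorem FinMod.lieComponent_le_comap (V : FinMod F G) (r : ℕ) (g : G) :
    V.lieComponent r ≤ (V.lieComponent r).comap (V.tensorAction g) := by
  set φ := TensorAlgebra.lift F (TensorAlgebra.ι F ∘ₗ V.ρ g) with hφ
  rintro x ⟨hx, hx'⟩
  refine ⟨?_, ?_⟩
  · have h : Submodule.map φ.toLinearMap
        (LinearMap.range (TensorAlgebra.ι F : V.carrier →ₗ[F] _) ^ r) ≤
        LinearMap.range (TensorAlgebra.ι F : V.carrier →ₗ[F] _) ^ r := by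
      rw [Submodule.map_pow]
      refine pow_le_pow_left' ?_ r
      rintro _ ⟨_, ⟨x, rfl⟩, rfl⟩
      exact ⟨V.ρ g x, by simp [hφ]⟩
    exact h ⟨x, hx, rfl⟩
  · have h : V.freeLie ≤ V.freeLie.comap (φ : _ →ₗ⁅F⁆ _) := by
      refine LieSubalgebra.lieSpan_le.2 ?_
      rintro _ ⟨x, rfl⟩
      refine LieSubalgebra.subset_lieSpan ⟨V.ρ g x, ?_⟩
      simp [hφ]
    exact h hx'

/-- The Lie power `L^r(V) = T^r(V) ∩ L(V)`. -/
noncomputable def FinMod.liePow (V : FinMod F G) (r : ℕ) : FinMod F G where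
  carrier := V.lieComponent r
  finite :=
    have : FiniteDimensional F
        ↥(LinearMap.range (TensorAlgebra.ι F : V.carrier →ₗ[F] _) ^ r) :=
      .of_fg (by
        rw [LinearMap.range_eq_map]
        exact (Module.Finite.fg_top.map (TensorAlgebra.ι F)).pow r)
    Submodule.finiteDimensional_of_le inf_le_left
  ρ := V.tensorAction.subrepresentation (V.lieComponent r) (V.lieComponent_le_comap r)

/-! ### The Green ring and power series over it -/

variable (F G)

/-- The relations `[U ⊕ V] = [U] + [V]`. -/
noncomputable def greenIdeal : Ideal (MonoidAlgebra ℤ (IsoClass F G)) :=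
  Ideal.span {x | ∃ U V : FinMod F G, x = MonoidAlgebra.of ℤ _ (U.sum V).isoClass -
    MonoidAlgebra.of ℤ _ U.isoClass - MonoidAlgebra.of ℤ _ V.isoClass}

/-- The Green ring `R_{FG}`: generated as an abelian group by the isomorphism classes of
finite-dimensional `FG`-modules, subject to `[U ⊕ V] = [U] + [V]`, with `[U] [V] = [U ⊗ V]`.
(The relations are stable under multiplication by classes, so the ideal that they generate is
the additive subgroup that they generate.) -/
def GreenRing : Type (max (u + 1) v) := MonoidAlgebra ℤ (IsoClass F G) ⧸ greenIdeal F G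

noncomputable instance : CommRing (GreenRing F G) :=
  inferInstanceAs (CommRing (MonoidAlgebra ℤ (IsoClass F G) ⧸ greenIdeal F G))

/-- The quotient map onto the Green ring. -/
noncomputable def GreenRing.mk : MonoidAlgebra ℤ (IsoClass F G) →+* GreenRing F G :=
  Ideal.Quotient.mk (greenIdeal F G)

/-- `Γ_{FG} = ℚ ⊗ R_{FG}`. -/
def Gam : Type (max (u + 1) v) := ℚ ⊗[ℤ] GreenRing F G

noncomputable instance : CommRing (Gam F G) := inferInstanceAs (CommRing (ℚ ⊗[ℤ] GreenRing F G))

noncomputable instance : Algebra ℚ (Gam F G) := inferInstanceAs (Algebra ℚ (ℚ ⊗[ℤ] GreenRing F G))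

/-- The ring homomorphism `R_{FG} → Γ_{FG}`, `x ↦ 1 ⊗ x`. -/
noncomputable def Gam.ofGreen : GreenRing F G →+* Gam F G :=
  (Algebra.TensorProduct.includeRight : GreenRing F G →ₐ[ℤ] ℚ ⊗[ℤ] GreenRing F G).toRingHom

/-- `Π = Γ_{FG}[[t]]`. -/
abbrev Ser : Type (max (u + 1) v) := (Gam F G)⟦X⟧

/-- `tΠ`: the power series with constant term `0`. -/
noncomputable abbrev TSer : Ideal (Ser F G) := RingHom.ker PowerSeries.constantCoeff

/-- `1 + tΠ`: the power series with constant term `1`. -/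
abbrev OneTSer : Type (max (u + 1) v) := {f : Ser F G // PowerSeries.constantCoeff f = 1}

variable {F G}

/-- The element of `R_{FG}` determined by a module. -/
noncomputable def FinMod.green (V : FinMod F G) : GreenRing F G :=
  GreenRing.mk F G (MonoidAlgebra.of ℤ _ V.isoClass)

/-- The element of `Γ_{FG}` determined by a module. -/
noncomputable def FinMod.cls (V : FinMod F G) : Gam F G :=
  Gam.ofGreen F G V.green

/-- `exp : tΠ → 1 + tΠ`, `exp(f) = 1 + f + f²/2! + ⋯`. -/
noncomputable def expSer (f : TSer F G) : OneTSer F G :=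
  ⟨(PowerSeries.exp (Gam F G)).subst (f : Ser F G), by
    have hf : PowerSeries.constantCoeff (f : Ser F G) = 0 := f.2
    have h : PowerSeries.HasSubst (f : Ser F G) := PowerSeries.HasSubst.of_constantCoeff_zero' hf
    have h1 := PowerSeries.constantCoeff_subst_eq_zero (a := (f : Ser F G)) hf
      (PowerSeries.exp (Gam F G) - 1) (by simp)
    rw [PowerSeries.subst_sub h, ← PowerSeries.coe_substAlgHom h, map_one] at h1
    rw [← PowerSeries.coe_substAlgHom h]
    exact sub_eq_zero.1 (by simpa [← PowerSeries.constantCoeff_eq] using h1)⟩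

/-! ### The function `S*` -/

/-- `S(V,t) = 1 + S^1(V) t + S^2(V) t² + ⋯`. -/
noncomputable def FinMod.symSeries (V : FinMod F G) : OneTSer F G :=
  ⟨PowerSeries.mk fun n => if n = 0 then 1 else (V.symPow n).cls, by
    simp [← PowerSeries.coeff_zero_eq_constantCoeff_apply,
      -PowerSeries.coeff_zero_eq_constantCoeff]⟩

variable (F G) in
/-- The property defining the `ℚ`-linear function `ψ : Γ_{FG} → tΠ`, namely
`ψ(V) = log S(V,t)` for all modules `V`. -/
def IsPsi (ψ : Gam F G →ₗ[ℚ] TSer F G) : Prop :=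
  ∀ V : FinMod F G, (ψ V.cls : Ser F G) = PowerSeries.logOf (V.symSeries : Ser F G)

variable (F G) in
/-- The `ℚ`-linear function `ψ : Γ_{FG} → tΠ` with `ψ(V) = log S(V,t)` for all modules `V`. -/
noncomputable def psi : Gam F G →ₗ[ℚ] TSer F G := Classical.epsilon (IsPsi F G)

/-- `S⁺(A₁ t + A₂ t² + ⋯) = ψ(A₁) + ψ(A₂)_{t ↦ t²} + ψ(A₃)_{t ↦ t³} + ⋯`. Since `ψ(Aᵢ)_{t ↦ tⁱ}`
is divisible by `tⁱ`, only the terms with `1 ≤ i ≤ n` contribute to the coefficient of `tⁿ`. -/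
noncomputable def SPlus (f : TSer F G) : TSer F G :=
  ⟨PowerSeries.mk fun n => ∑ i ∈ Finset.range n, PowerSeries.coeff n
      (PowerSeries.expand (i + 1) i.succ_ne_zero
        (psi F G (PowerSeries.coeff (i + 1) (f : Ser F G)) : Ser F G)), by
    simp [RingHom.mem_ker, ← PowerSeries.coeff_zero_eq_constantCoeff_apply,
      -PowerSeries.coeff_zero_eq_constantCoeff]⟩

/-- `S* = exp ∘ S⁺ : tΠ → 1 + tΠ`. -/
noncomputable def SStar (f : TSer F G) : OneTSer F G := expSer (SPlus f)

/-! ### The function `L*` -/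

/-- The series `V t^r`, for `r ≥ 1`. -/
noncomputable def FinMod.single (V : FinMod F G) (r : ℕ) (hr : r ≠ 0) : TSer F G :=
  ⟨PowerSeries.monomial r V.cls, by
    simp [RingHom.mem_ker, ← PowerSeries.coeff_zero_eq_constantCoeff_apply,
      -PowerSeries.coeff_zero_eq_constantCoeff,
      PowerSeries.coeff_monomial, hr.symm]⟩

/-- The series `L^1(V) t^r + L^2(V) t^{2r} + L^3(V) t^{3r} + ⋯`, for `r ≥ 1`. -/
noncomputable def FinMod.lieSeries (V : FinMod F G) (r : ℕ) (hr : r ≠ 0) : TSer F G :=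
  ⟨PowerSeries.expand r hr (PowerSeries.mk fun n => if n = 0 then 0 else (V.liePow n).cls), by
    rw [RingHom.mem_ker, PowerSeries.constantCoeff_expand]
    simp [← PowerSeries.coeff_zero_eq_constantCoeff_apply,
      -PowerSeries.coeff_zero_eq_constantCoeff]⟩

variable (F G) in
/-- The properties which determine the Lie module function `𝓛 : tΠ → tΠ`:
`𝓛(V t^r) = L^1(V) t^r + L^2(V) t^{2r} + ⋯` for all modules `V` and `r ≥ 1`;
`𝓛(f) + 𝓛(g) = 𝓛(f + g - fg)`; and `𝓛(t^n Π) ⊆ t^n Π`. -/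
structure IsLieModuleFunction (L : TSer F G → TSer F G) : Prop where
  map_single : ∀ (V : FinMod F G) (r : ℕ) (hr : r ≠ 0), L (V.single r hr) = V.lieSeries r hr
  map_circ : ∀ f g : TSer F G, L f + L g = L (f + g - (f : Ser F G) • g)
  map_order : ∀ (n : ℕ) (f : TSer F G), (PowerSeries.X : Ser F G) ^ n ∣ (f : Ser F G) →
    (PowerSeries.X : Ser F G) ^ n ∣ (L f : Ser F G)

variable (F G) in
/-- The Lie module function `𝓛 : tΠ → tΠ`. -/
noncomputable def lieModuleFunction : TSer F G → TSer F G :=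
  Classical.epsilon (IsLieModuleFunction F G)

/-- `L*(f) = -𝓛(1 - f)`, for `f ∈ 1 + tΠ`. -/
noncomputable def LStar (f : OneTSer F G) : TSer F G :=
  -lieModuleFunction F G ⟨1 - (f : Ser F G), by simp [RingHom.mem_ker, f.2]⟩

end GreenRingLie

/-! Existence of `ψ`: in the Green ring `S(U ⊕ V, t) = S(U, t) S(V, t)` (`symSeries_sum`), so `V ↦
log S(V, t)` is additive and extends to `Γ`. Classes of modules span `Γ` over `ℚ`, whence
uniqueness. Since `ψ(a) = a t + ⋯`, the additive map `S⁺` is unitriangular for the filtration by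
powers of `t`; hence `S⁺` and `S* = exp ∘ S⁺` are bijective and respect the filtration, and `S*`
turns sums into products, with `S*(V t^r) = S(V, t^r)`.

The heart is a Poincaré–Birkhoff–Witt theorem with group action: `T(V)` has the class of the tensor
product of all `S(L^k(V))`, that is, `S*(L^1(V) t^r + L^2(V) t^{2r} + ⋯) = (1 - V t^r)⁻¹`
(`SStar_lieSeries_mul`). To prove it, let `A_k` be the subalgebra of `T(V)` generated by the Lie
powers of degree at least `k`. Then `A_1 = T(V)`, and for `k ≥ 1` the map `x^n ⊗ c ↦ x^n c` is an
equivariant graded isomorphism `S(L^k(V)) ⊗ A_{k+1} ≅ A_k` (`tailSeries_eq_mul`). It is onto because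
commutators with `L^k(V)` preserve `A_{k+1}` and, in characteristic `0`, powers span symmetric
products. It is one-to-one because the comultiplication of `T(V)` provides operators acting on `x^n
c` as differentiation in `x` (`exists_derivative`). As `A_k` has no components in degrees strictly
between `0` and `k`, iterating gives the product formula.

Consequently `f ↦ -(S*)⁻¹(1 - f)` is a Lie module function. Conversely, for any Lie module function
`𝓛`, the map `f ↦ 𝓛(1 - S*(f)) + f` is `ℚ`-linear, respects the filtration and kills `L^1(V) t^r +
L^2(V) t^{2r} + ⋯`. The leading terms `V t^r` of these series span every degree, so the map is `0`.
This gives at once the uniqueness of `𝓛` and the fact that `L*` inverts `S*`. -/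

namespace PowerSeries

/-! ### Logarithm and exponential of power series. -/

variable {A : Type*} [CommRing A]

theorem hasSubst_sub_one {f : A⟦X⟧} (hf : constantCoeff f = 1) : HasSubst (f - 1) :=
  HasSubst.of_constantCoeff_zero' (by simp [hf])

theorem isUnit_of_constantCoeff_eq_one {f : A⟦X⟧} (hf : constantCoeff f = 1) : IsUnit f :=
  isUnit_iff_constantCoeff.2 (by simp [hf])

/-- A power series without constant term maps multiples of `X ^ n` to multiples of `X ^ n`. -/
theorem X_pow_dvd_subst {f : A⟦X⟧} (hf : constantCoeff f = 0) {n : ℕ} (h : X ^ n ∣ f)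
    (p : A⟦X⟧) (hp : constantCoeff p = 0) : X ^ n ∣ p.subst f := by
  have hs : HasSubst f := HasSubst.of_constantCoeff_zero' hf
  obtain ⟨q, rfl⟩ := X_dvd_iff.2 hp
  rw [subst_mul hs, subst_X hs]
  exact Dvd.dvd.mul_right h _

variable [Algebra ℚ A]

/-- Over a `ℚ`-algebra a power series is determined by its derivative and constant term; with this
formula for the logarithmic derivative, the identities below are checked by comparing both. -/
theorem derivative_logOf_mul {f : A⟦X⟧} (hf : constantCoeff f = 1) :
    d⁄dX A (logOf f) * f = d⁄dX A f := by
  have hs := hasSubst_sub_one hf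
  have h1 : d⁄dX A (log A) * (1 + X) = 1 := by
    rw [deriv_log]
    ext n
    rcases n with _ | n
    · simp [mul_add]
    · rw [mul_add, map_add, coeff_succ_mul_X]
      simp [pow_succ]
  rw [logOf_eq, derivative_subst hs]
  have h2 := congrArg (fun p => p.subst (f - 1)) h1
  simp only [← coe_substAlgHom hs, map_mul, map_add, map_one, substAlgHom_X hs] at h2 ⊢
  have h3 : d⁄dX A (f - 1) = d⁄dX A f := by rw [map_sub, derivative_one, sub_zero]
  rw [h3, mul_right_comm]
  linear_combination (d⁄dX A f) * h2

theorem derivative_exp_subst {f : A⟦X⟧} (hf : constantCoeff f = 0) :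
    d⁄dX A ((exp A).subst f) = (exp A).subst f * d⁄dX A f := by
  rw [derivative_subst (HasSubst.of_constantCoeff_zero' hf), derivative_exp]

theorem constantCoeff_exp_subst {f : A⟦X⟧} (hf : constantCoeff f = 0) :
    constantCoeff ((exp A).subst f) = 1 := by
  have h : HasSubst f := HasSubst.of_constantCoeff_zero' hf
  have h1 := constantCoeff_subst_eq_zero (a := f) hf (exp A - 1) (by simp)
  rw [subst_sub h, ← coe_substAlgHom h, map_one] at h1
  rw [← coe_substAlgHom h]
  exact sub_eq_zero.1 (by simpa [← constantCoeff_eq] using h1)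

theorem isAddTorsionFree_of_rat : IsAddTorsionFree A := .of_module_rat A

theorem logOf_mul {f g : A⟦X⟧} (hf : constantCoeff f = 1) (hg : constantCoeff g = 1) :
    logOf (f * g) = logOf f + logOf g := by
  have := isAddTorsionFree_of_rat (A := A)
  have hfg : constantCoeff (f * g) = 1 := by simp [hf, hg]
  refine derivative.ext ?_ ?_
  · apply (isUnit_of_constantCoeff_eq_one hfg).mul_right_cancel
    rw [derivative_logOf_mul hfg, map_add, Derivation.leibniz, smul_eq_mul, smul_eq_mul]
    linear_combination -g * derivative_logOf_mul hf - f * derivative_logOf_mul hg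
  · rw [constantCoeff_logOf hfg, map_add, constantCoeff_logOf hf, constantCoeff_logOf hg, add_zero]

theorem logOf_exp_subst {f : A⟦X⟧} (hf : constantCoeff f = 0) :
    logOf ((exp A).subst f) = f := by
  have := isAddTorsionFree_of_rat (A := A)
  have h := constantCoeff_exp_subst hf
  refine derivative.ext ?_ ?_
  · apply (isUnit_of_constantCoeff_eq_one h).mul_right_cancel
    rw [derivative_logOf_mul h, derivative_exp_subst hf, mul_comm]
  · rw [constantCoeff_logOf h, hf]

/-- The quotient of the two sides has derivative `0` and constant term `1`. -/
theorem exp_subst_logOf {f : A⟦X⟧} (hf : constantCoeff f = 1) :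
    (exp A).subst (logOf f) = f := by
  have := isAddTorsionFree_of_rat (A := A)
  have hl := constantCoeff_logOf hf
  have h := constantCoeff_exp_subst hl
  obtain ⟨u, rfl⟩ := isUnit_of_constantCoeff_eq_one hf
  have key : (exp A).subst (logOf (u : A⟦X⟧)) * ((u⁻¹ : A⟦X⟧ˣ) : A⟦X⟧) = 1 := by
    refine derivative.ext ?_ ?_
    · rw [Derivation.leibniz, derivative_inv, derivative_exp_subst hl, derivative_one,
        smul_eq_mul, smul_eq_mul]
      have h1 := derivative_logOf_mul hf
      have h2 : ((u⁻¹ : A⟦X⟧ˣ) : A⟦X⟧) * u = 1 := by simp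
      linear_combination (exp A).subst (logOf (u : A⟦X⟧)) * ((u⁻¹ : A⟦X⟧ˣ) : A⟦X⟧) ^ 2 * h1
        - (exp A).subst (logOf (u : A⟦X⟧)) * ((u⁻¹ : A⟦X⟧ˣ) : A⟦X⟧) *
          d⁄dX A (logOf (u : A⟦X⟧)) * h2
    · have h3 : constantCoeff ((u : A⟦X⟧) * ((u⁻¹ : A⟦X⟧ˣ) : A⟦X⟧)) = 1 := by simp
      rw [map_mul, hf, one_mul] at h3
      rw [map_mul, h, h3, map_one, one_mul]
  calc _ = (exp A).subst (logOf (u : A⟦X⟧)) * ((u⁻¹ : A⟦X⟧ˣ) : A⟦X⟧) * u := by simp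
    _ = u := by rw [key, one_mul]

theorem exp_subst_add {f g : A⟦X⟧} (hf : constantCoeff f = 0) (hg : constantCoeff g = 0) :
    (exp A).subst (f + g) = (exp A).subst f * (exp A).subst g := by
  have h1 := constantCoeff_exp_subst hf
  have h2 := constantCoeff_exp_subst hg
  have h3 : constantCoeff ((exp A).subst f * (exp A).subst g) = 1 := by simp [h1, h2]
  rw [← exp_subst_logOf h3, logOf_mul h1 h2, logOf_exp_subst hf, logOf_exp_subst hg]

theorem logOf_expand {f : A⟦X⟧} (hf : constantCoeff f = 1) (p : ℕ) (hp : p ≠ 0) :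
    logOf (expand p hp f) = expand p hp (logOf f) := by
  rw [logOf_eq, logOf_eq, expand_apply p hp (subst _ _),
    subst_comp_subst_apply (hasSubst_sub_one hf) (HasSubst.X_pow hp), ← expand_apply p hp,
    map_sub, map_one]

theorem X_pow_dvd_exp_subst_sub_one {f : A⟦X⟧} (hf : constantCoeff f = 0) {n : ℕ}
    (h : X ^ n ∣ f) : X ^ n ∣ (exp A).subst f - 1 := by
  have hs : HasSubst f := HasSubst.of_constantCoeff_zero' hf
  have := X_pow_dvd_subst hf h (exp A - 1) (by simp)
  rwa [← coe_substAlgHom hs, map_sub, map_one, coe_substAlgHom hs] at this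

theorem X_pow_dvd_logOf {f : A⟦X⟧} (hf : constantCoeff f = 1) {n : ℕ}
    (h : X ^ n ∣ f - 1) : X ^ n ∣ logOf f :=
  X_pow_dvd_subst (by simp [hf]) h _ constantCoeff_log

theorem coeff_one_logOf {f : A⟦X⟧} (hf : constantCoeff f = 1) :
    coeff 1 (logOf f) = coeff 1 f := by
  have h := congrArg constantCoeff (derivative_logOf_mul hf)
  rw [map_mul, hf, mul_one] at h
  simp only [← coeff_zero_eq_constantCoeff_apply, coeff_derivative] at h
  simpa using h

end PowerSeries

namespace GreenRingLie

/-! ### Additive invariants of modules and the Green ring. -/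

section GreenRing

variable {F : Type u} [Field F] {G : Type v} [Group G]

theorem FinMod.equiv_of_linearEquiv {U V : FinMod F G} (e : U.carrier ≃ₗ[F] V.carrier)
    (he : ∀ g x, e (U.ρ g x) = V.ρ g (e x)) : U ≈ V :=
  ⟨.mk e fun g => LinearMap.ext fun x => he g x⟩

theorem FinMod.cls_congr {U V : FinMod F G} (h : U ≈ V) : U.cls = V.cls := by
  have : U.isoClass = V.isoClass := Quotient.sound h
  rw [FinMod.cls, FinMod.cls, FinMod.green, FinMod.green, this]

theorem FinMod.cls_sum (U V : FinMod F G) : (U.sum V).cls = U.cls + V.cls := by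
  rw [FinMod.cls, FinMod.cls, FinMod.cls, ← map_add]
  congr 1
  rw [FinMod.green, FinMod.green, FinMod.green, ← map_add, ← sub_eq_zero, ← map_sub]
  refine Ideal.Quotient.eq_zero_iff_mem.2 (Ideal.subset_span ⟨U, V, ?_⟩)
  abel

theorem FinMod.cls_tensor (U V : FinMod F G) : (U.tensor V).cls = U.cls * V.cls := by
  rw [FinMod.cls, FinMod.cls, FinMod.cls, ← map_mul]
  congr 1
  rw [FinMod.green, FinMod.green, FinMod.green, ← map_mul, ← map_mul]
  rfl

theorem FinMod.cls_triv : (FinMod.triv : FinMod F G).cls = 1 := by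
  have : (FinMod.triv : FinMod F G).green = 1 := map_one (GreenRing.mk F G)
  rw [FinMod.cls, this, map_one]

theorem FinMod.cls_eq_zero (U : FinMod F G) [Subsingleton U.carrier] : U.cls = 0 := by
  have h := FinMod.cls_sum U U
  have h' : (U.sum U).cls = U.cls := by
    have : Subsingleton (U.sum U).carrier := inferInstanceAs (Subsingleton (U.carrier × U.carrier))
    exact FinMod.cls_congr (FinMod.equiv_of_linearEquiv
      ⟨0, 0, fun _ => Subsingleton.elim _ _, fun _ => Subsingleton.elim _ _⟩
      fun _ _ => Subsingleton.elim _ _)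
  rw [h'] at h
  simpa using h

theorem span_cls_eq_top :
    Submodule.span ℚ (Set.range (FinMod.cls : FinMod F G → Gam F G)) = ⊤ := by
  rw [eq_top_iff]
  rintro x -
  have key : ∀ a : MonoidAlgebra ℤ (IsoClass F G), Gam.ofGreen F G (GreenRing.mk F G a) ∈
      Submodule.span ℚ (Set.range (FinMod.cls : FinMod F G → Gam F G)) := by
    intro a
    induction a using MonoidAlgebra.induction_on with
    | of m =>
      induction m using Quotient.inductionOn with
      | h V => exact Submodule.subset_span ⟨V, rfl⟩
    | add a b ha hb => rw [map_add, map_add]; exact add_mem ha hb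
    | smul r a ha => rw [map_zsmul, map_zsmul]; exact zsmul_mem ha r
  change ℚ ⊗[ℤ] GreenRing F G at x
  induction x using TensorProduct.induction_on with
  | zero => exact zero_mem _
  | tmul q y =>
    obtain ⟨a, rfl⟩ := Ideal.Quotient.mk_surjective y
    have : (q ⊗ₜ[ℤ] GreenRing.mk F G a : ℚ ⊗[ℤ] GreenRing F G) =
        q • ((1 : ℚ) ⊗ₜ[ℤ] GreenRing.mk F G a) := by
      rw [TensorProduct.smul_tmul', smul_eq_mul, mul_one]
    change (q ⊗ₜ[ℤ] GreenRing.mk F G a : ℚ ⊗[ℤ] GreenRing F G) ∈ _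
    rw [this]
    exact Submodule.smul_mem _ q (key a)
  | add x y hx hy => exact add_mem hx hy

theorem Gam.linearMap_ext {H : Type*} [AddCommGroup H] [Module ℚ H] {φ ψ : Gam F G →ₗ[ℚ] H}
    (h : ∀ V : FinMod F G, φ V.cls = ψ V.cls) : φ = ψ :=
  LinearMap.ext_on span_cls_eq_top (by rintro _ ⟨V, rfl⟩; exact h V)

theorem FinMod.tensor_sum_equiv (W U V : FinMod F G) :
    W.tensor (U.sum V) ≈ (W.tensor U).sum (W.tensor V) := by
  refine FinMod.equiv_of_linearEquiv (TensorProduct.prodRight F F W.carrier U.carrier V.carrier) ?_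
  intro g x
  change ((TensorProduct.prodRight F F W.carrier U.carrier V.carrier).toLinearMap ∘ₗ
      TensorProduct.map (W.ρ g) ((U.ρ g).prodMap (V.ρ g))) x =
    ((TensorProduct.map (W.ρ g) (U.ρ g)).prodMap (TensorProduct.map (W.ρ g) (V.ρ g)) ∘ₗ
      (TensorProduct.prodRight F F W.carrier U.carrier V.carrier).toLinearMap) x
  congr 1
  apply TensorProduct.ext'
  rintro w ⟨u, v⟩
  simp

/-- An additive invariant of modules vanishes on the relations of the Green ring. -/
theorem greenIdeal_le_ker {H : Type*} [AddCommGroup H] (φ : MonoidAlgebra ℤ (IsoClass F G) →+ H)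
    (hφ : ∀ U V : FinMod F G, φ (MonoidAlgebra.of ℤ _ (U.sum V).isoClass) =
      φ (MonoidAlgebra.of ℤ _ U.isoClass) + φ (MonoidAlgebra.of ℤ _ V.isoClass))
    {x : MonoidAlgebra ℤ (IsoClass F G)} (hx : x ∈ greenIdeal F G) : φ x = 0 := by
  -- `φ` is only additive, so the induction over the ideal must carry an arbitrary multiplier. A
  -- multiple by a class `W` of a relation for `U`, `V` is the relation for `W ⊗ U`, `W ⊗ V`.
  suffices ∀ y, φ (y * x) = 0 by simpa using this 1
  rw [greenIdeal] at hx
  induction hx using Submodule.span_induction with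
  | mem x hx =>
    obtain ⟨U, V, rfl⟩ := hx
    intro y
    induction y using MonoidAlgebra.induction_on with
    | of m =>
      induction m using Quotient.inductionOn with
      | h W =>
        change φ (MonoidAlgebra.of ℤ _ W.isoClass * _) = 0
        have h1 : W.isoClass * (U.sum V).isoClass =
            ((W.tensor U).sum (W.tensor V)).isoClass :=
          Quotient.sound (FinMod.tensor_sum_equiv W U V)
        have h2 : ∀ U : FinMod F G, W.isoClass * U.isoClass = (W.tensor U).isoClass :=
          fun U => rfl
        rw [mul_sub, mul_sub, ← map_mul, ← map_mul, ← map_mul, h1, h2, h2, map_sub, map_sub, hφ]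
        abel
    | add a b ha hb => rw [add_mul, map_add, ha, hb, add_zero]
    | smul r a ha => rw [smul_mul_assoc, map_zsmul, ha, smul_zero]
  | zero => simp
  | add a b _ _ ha hb => intro y; rw [mul_add, map_add, ha, hb, add_zero]
  | smul a x _ hx => intro y; rw [smul_eq_mul, ← mul_assoc]; exact hx _

/-- An additive invariant of modules with values in a rational vector space extends linearly to
`Γ`. -/
theorem exists_linearMap_of_additive {H : Type*} [AddCommGroup H] [Module ℚ H]
    (f : FinMod F G → H) (hcongr : ∀ U V, U ≈ V → f U = f V)
    (hsum : ∀ U V, f (U.sum V) = f U + f V) :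
    ∃ φ : Gam F G →ₗ[ℚ] H, ∀ V : FinMod F G, φ V.cls = f V := by
  let f₀ : IsoClass F G → H := Quotient.lift f hcongr
  let f₁ : MonoidAlgebra ℤ (IsoClass F G) →+ H :=
    ((Finsupp.linearCombination ℤ f₀) ∘ₗ
      (MonoidAlgebra.coeffLinearEquiv ℤ).toLinearMap).toAddMonoidHom
  have hf₁ : ∀ V : FinMod F G, f₁ (MonoidAlgebra.of ℤ _ V.isoClass) = f V := by
    intro V
    exact (Finsupp.linearCombination_single ℤ (1 : ℤ) V.isoClass).trans (one_smul ℤ _)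
  let f₂ : GreenRing F G →+ H := QuotientAddGroup.lift (greenIdeal F G).toAddSubgroup f₁
    fun x hx => greenIdeal_le_ker f₁ (fun U V => by simp only [hf₁, hsum]) hx
  have hf₂ : ∀ V : FinMod F G, f₂ V.green = f V := hf₁
  let f₃ : ℚ ⊗[ℤ] GreenRing F G →ₗ[ℚ] H := f₂.toIntLinearMap.liftBaseChange ℚ
  refine ⟨f₃, fun V => ?_⟩
  change f₃ (1 ⊗ₜ V.green) = f V
  rw [LinearMap.liftBaseChange_tmul, one_smul]
  exact hf₂ V

end GreenRing

/-! ### Classes of stable subspaces. -/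

section SubCls

variable {F : Type u} [Field F] {G : Type v} [Group G]
  {X : Type u} [AddCommGroup X] [Module F X] {Y : Type u} [AddCommGroup Y] [Module F Y]

/-- A stable finite-dimensional subspace of a representation as a module. -/
def FinMod.ofSub (ρ : Representation F G X) (W : Submodule F X)
    (h : ∀ g, W ≤ W.comap (ρ g)) (hfin : FiniteDimensional F W) : FinMod F G where
  carrier := W
  ρ := ρ.subrepresentation W h

open Classical in
/-- The class in `Γ` of a stable finite-dimensional subspace of a representation (and `0` for
other subspaces). -/
noncomputable def subCls (ρ : Representation F G X) (W : Submodule F X) : Gam F G :=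
  if h : (∀ g, W ≤ W.comap (ρ g)) ∧ FiniteDimensional F W then
    (FinMod.ofSub ρ W h.1 h.2).cls else 0

/-- Because `subCls` depends on the subspace alone, an equality of subspaces can be rewritten
without transporting the proofs of stability and finiteness. -/
theorem subCls_eq (ρ : Representation F G X) (W : Submodule F X)
    (h : ∀ g, W ≤ W.comap (ρ g)) (hfin : FiniteDimensional F W) :
    subCls ρ W = (FinMod.ofSub ρ W h hfin).cls :=
  dif_pos ⟨h, hfin⟩

theorem subCls_range {ρ : Representation F G X} (U : FinMod F G) (f : U.carrier →ₗ[F] X)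
    (hf : Function.Injective f) (hρ : ∀ g x, f (U.ρ g x) = ρ g (f x)) :
    subCls ρ (LinearMap.range f) = U.cls := by
  rw [subCls_eq ρ (LinearMap.range f) (by rintro g _ ⟨x, rfl⟩; exact ⟨_, hρ g x⟩) inferInstance]
  refine (FinMod.cls_congr (FinMod.equiv_of_linearEquiv (LinearEquiv.ofInjective f hf) ?_)).symm
  intro g x
  exact Subtype.ext (hρ g x)

theorem subCls_range_tensor {ρ : Representation F G X} (U V : FinMod F G)
    (f : U.carrier ⊗[F] V.carrier →ₗ[F] X) (hf : Function.Injective f)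
    (hρ : ∀ g x y, f (U.ρ g x ⊗ₜ V.ρ g y) = ρ g (f (x ⊗ₜ y))) :
    subCls ρ (LinearMap.range f) = U.cls * V.cls := by
  rw [← FinMod.cls_tensor]
  refine subCls_range (U.tensor V) f hf fun g x => ?_
  change (f ∘ₗ TensorProduct.map (U.ρ g) (V.ρ g)) x = (ρ g ∘ₗ f) x
  congr 1
  exact TensorProduct.ext' fun x y => hρ g x y

theorem subCls_map {ρ : Representation F G X} {τ : Representation F G Y} (W : Submodule F X)
    (h : ∀ g, W ≤ W.comap (ρ g)) (hfin : FiniteDimensional F W) (f : X →ₗ[F] Y)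
    (hf : ∀ x ∈ W, f x = 0 → x = 0) (hρ : ∀ g, ∀ x ∈ W, f (ρ g x) = τ g (f x)) :
    subCls τ (W.map f) = subCls ρ W := by
  rw [subCls_eq ρ W h hfin]
  have hr : LinearMap.range (f ∘ₗ W.subtype) = W.map f := by
    rw [LinearMap.range_comp, Submodule.range_subtype]
  have hi : Function.Injective (f ∘ₗ W.subtype) :=
    (injective_iff_map_eq_zero _).2 fun x hx => Subtype.ext (hf x x.2 hx)
  rw [← hr]
  exact subCls_range (ρ := τ) (FinMod.ofSub ρ W h hfin) (f ∘ₗ W.subtype) hi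
    fun g (x : W) => hρ g x x.2

theorem subCls_bot (ρ : Representation F G X) : subCls ρ ⊥ = 0 := by
  rw [subCls_eq ρ ⊥ (fun _ => bot_le) inferInstance]
  have : Subsingleton (FinMod.ofSub ρ ⊥ (fun _ => bot_le) inferInstance).carrier :=
    inferInstanceAs (Subsingleton (⊥ : Submodule F X))
  exact FinMod.cls_eq_zero _

theorem subCls_sup {ρ : Representation F G X} {W W' : Submodule F X}
    (h : ∀ g, W ≤ W.comap (ρ g)) (hfin : FiniteDimensional F W)
    (h' : ∀ g, W' ≤ W'.comap (ρ g)) (hfin' : FiniteDimensional F W') (hd : Disjoint W W') :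
    subCls ρ (W ⊔ W') = subCls ρ W + subCls ρ W' := by
  rw [subCls_eq ρ W h hfin, subCls_eq ρ W' h' hfin', ← FinMod.cls_sum]
  have hr : LinearMap.range (W.subtype.coprod W'.subtype) = W ⊔ W' := by
    rw [LinearMap.range_coprod, Submodule.range_subtype, Submodule.range_subtype]
  have hi : Function.Injective (W.subtype.coprod W'.subtype) := by
    apply LinearMap.ker_eq_bot.1
    rw [LinearMap.ker_coprod_of_disjoint_range]
    · simp only [Submodule.ker_subtype, Submodule.prod_bot]
    · simpa using hd
  rw [← hr]
  exact subCls_range (ρ := ρ) ((FinMod.ofSub ρ W h hfin).sum (FinMod.ofSub ρ W' h' hfin')) _ hi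
    fun g (x : W × W') => (map_add (ρ g) (x.1 : X) (x.2 : X)).symm

theorem subCls_biSup {ρ : Representation F G X} {ι : Type*} [DecidableEq ι] (s : Finset ι)
    (W : ι → Submodule F X) (h : ∀ i ∈ s, ∀ g, W i ≤ (W i).comap (ρ g))
    (hfin : ∀ i ∈ s, FiniteDimensional F (W i))
    (hind : s.SupIndep W) :
    subCls ρ (⨆ i ∈ s, W i) = ∑ i ∈ s, subCls ρ (W i) := by
  induction s using Finset.induction_on with
  | empty => simp [subCls_bot]
  | insert a s ha ih =>
    have hs : ∀ i ∈ s, i ∈ insert a s := fun i hi => Finset.mem_insert_of_mem hi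
    rw [Finset.iSup_insert, Finset.sum_insert ha, subCls_sup,
      ih (fun i hi => h i (hs i hi)) (fun i hi => hfin i (hs i hi))
        (hind.subset (Finset.subset_insert a s))]
    · exact h a (Finset.mem_insert_self a s)
    · exact hfin a (Finset.mem_insert_self a s)
    · intro g
      refine iSup₂_le fun i hi => (h i (hs i hi) g).trans (Submodule.comap_mono ?_)
      exact le_iSup₂_of_le i hi le_rfl
    · rw [← Finset.sup_eq_iSup]
      have : ∀ i : s, FiniteDimensional F (W i) := fun i => hfin i (hs i i.2)
      rw [Finset.sup_eq_iSup, iSup_subtype']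
      exact Submodule.finiteDimensional_iSup _
    · rw [← Finset.sup_eq_iSup]
      exact hind (Finset.subset_insert a s) (Finset.mem_insert_self a s) ha

end SubCls

end GreenRingLie

/-! ### The symmetric algebra of a direct sum. -/

namespace SymmetricAlgebra

variable {R M N : Type*} [CommRing R] [AddCommGroup M] [Module R M] [AddCommGroup N] [Module R N]

/-- The trivial square-zero extension of `R` by `M` is commutative and contains `M`, so the
inclusion of `M` in it factors through `ι`. -/
theorem ι_injective : Function.Injective (ι R M) := by
  let : Module Rᵐᵒᵖ M := Module.compHom _ ((RingHom.id R).fromOpposite mul_comm)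
  have : IsCentralScalar R M := ⟨fun r m => rfl⟩
  intro x y h
  have h' := congrArg (lift (TrivSqZeroExt.inrHom R M)) h
  rw [lift_ι_apply, lift_ι_apply] at h'
  exact TrivSqZeroExt.inr_injective h'

/-- The map of symmetric algebras induced by a linear map. -/
noncomputable def map (f : M →ₗ[R] N) : SymmetricAlgebra R M →ₐ[R] SymmetricAlgebra R N :=
  lift (ι R N ∘ₗ f)

@[simp]
theorem map_ι (f : M →ₗ[R] N) (x : M) : map f (ι R M x) = ι R N (f x) := by
  simp [map]

/-- The multiplication map `S(M) ⊗ S(N) → S(M ⊕ N)`. -/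
noncomputable def ofTensor :
    SymmetricAlgebra R M ⊗[R] SymmetricAlgebra R N →ₐ[R] SymmetricAlgebra R (M × N) :=
  Algebra.TensorProduct.productMap (map (LinearMap.inl R M N)) (map (LinearMap.inr R M N))

/-- The homomorphism with `(x, y) ↦ x ⊗ 1 + 1 ⊗ y` is a left inverse. -/
theorem ofTensor_injective : Function.Injective (ofTensor (R := R) (M := M) (N := N)) := by
  let η : SymmetricAlgebra R (M × N) →ₐ[R] SymmetricAlgebra R M ⊗[R] SymmetricAlgebra R N :=
    lift ((Algebra.TensorProduct.includeLeft.toLinearMap ∘ₗ ι R M).coprod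
      (Algebra.TensorProduct.includeRight.toLinearMap ∘ₗ ι R N))
  have h : η.comp ofTensor = AlgHom.id R _ := by
    apply Algebra.TensorProduct.ext
    · apply algHom_ext
      ext x
      simp [η, ofTensor]
    · apply algHom_ext
      ext x
      simp [η, ofTensor]
  exact Function.LeftInverse.injective (g := η) fun x => DFunLike.congr_fun h x

theorem range_ι_prod : LinearMap.range (ι R (M × N)) =
    (LinearMap.range (ι R M)).map (map (LinearMap.inl R M N)).toLinearMap ⊔
      (LinearMap.range (ι R N)).map (map (LinearMap.inr R M N)).toLinearMap := by
  apply le_antisymm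
  · rintro _ ⟨⟨x, y⟩, rfl⟩
    have : ι R (M × N) (x, y) = ι R _ (x, 0) + ι R _ (0, y) := by rw [← map_add]; simp
    rw [this]
    exact add_mem (Submodule.mem_sup_left ⟨_, ⟨x, rfl⟩, by simp⟩)
      (Submodule.mem_sup_right ⟨_, ⟨y, rfl⟩, by simp⟩)
  · refine sup_le ?_ ?_
    · rintro _ ⟨_, ⟨x, rfl⟩, rfl⟩
      exact ⟨(x, 0), by simp⟩
    · rintro _ ⟨_, ⟨x, rfl⟩, rfl⟩
      exact ⟨(0, x), by simp⟩

end SymmetricAlgebra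

namespace Submodule

variable {R A : Type*} [CommSemiring R] [Semiring A] [Algebra R A]

theorem finsetSum_eq_biSup {ι : Type*} (s : Finset ι) (W : ι → Submodule R A) :
    ∑ i ∈ s, W i = ⨆ i ∈ s, W i := by
  classical
  induction s using Finset.induction_on with
  | empty => simp
  | insert a s ha ih => rw [Finset.sum_insert ha, Finset.iSup_insert, ih]; rfl

/-- This is the binomial theorem in the semiring of submodules. Addition there is idempotent, so
nonzero binomial coefficients disappear. -/
theorem sup_pow_of_commute {P Q : Submodule R A} (h : Commute P Q) (n : ℕ) :
    (P ⊔ Q) ^ n = ⨆ i ∈ Finset.range (n + 1), P ^ i * Q ^ (n - i) := by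
  rw [← Submodule.add_eq_sup, h.add_pow', Finset.Nat.sum_antidiagonal_eq_sum_range_succ_mk,
    finsetSum_eq_biSup]
  refine iSup_congr fun i => iSup_congr fun hi => ?_
  exact nsmul_eq_self (Nat.choose_pos (Nat.lt_succ_iff.1 (Finset.mem_range.1 hi))).ne' _

end Submodule

theorem LinearMap.range_mul'_comp_map {R A P Q : Type*} [CommSemiring R] [Semiring A] [Algebra R A]
    [AddCommMonoid P] [Module R P] [AddCommMonoid Q] [Module R Q] (f : P →ₗ[R] A) (g : Q →ₗ[R] A) :
    range (mul' R A ∘ₗ TensorProduct.map f g) = range f * range g := by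
  apply le_antisymm
  · rintro _ ⟨t, rfl⟩
    induction t using TensorProduct.induction_on with
    | zero => simp
    | tmul x y => exact Submodule.mul_mem_mul ⟨x, rfl⟩ ⟨y, rfl⟩
    | add x y hx hy => rw [map_add]; exact add_mem hx hy
  · rw [Submodule.mul_le]
    rintro _ ⟨x, rfl⟩ _ ⟨y, rfl⟩
    exact ⟨x ⊗ₜ y, rfl⟩

/-! ### Symmetric powers in the Green ring and the function `ψ`. -/

namespace GreenRingLie

variable {F : Type u} [Field F] {G : Type v} [Group G]

theorem subCls_range_mul {A : Type u} [Ring A] [Algebra F A] {ρ : Representation F G A}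
    (hmul : ∀ g a b, ρ g (a * b) = ρ g a * ρ g b) (U V : FinMod F G)
    (f : U.carrier →ₗ[F] A) (f' : V.carrier →ₗ[F] A)
    (hf : ∀ g x, f (U.ρ g x) = ρ g (f x)) (hf' : ∀ g x, f' (V.ρ g x) = ρ g (f' x))
    (hinj : Function.Injective (LinearMap.mul' F A ∘ₗ TensorProduct.map f f')) :
    subCls ρ (LinearMap.range f * LinearMap.range f') = U.cls * V.cls := by
  rw [← LinearMap.range_mul'_comp_map]
  refine subCls_range_tensor U V _ hinj fun g x y => ?_
  simp [hmul, hf, hf']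

/-- Eigenspaces for distinct eigenvalues are independent, and the powers of `2` are distinct in
characteristic `0`. -/
theorem iSupIndep_of_eigenvalue_two_pow {X : Type*} [CharZero F] [AddCommGroup X] [Module F X]
    (D : Module.End F X) (W : ℕ → Submodule F X) (h : ∀ i, ∀ x ∈ W i, D x = (2 : F) ^ i • x) :
    iSupIndep W := by
  have h2 : Function.Injective fun i : ℕ => (2 : F) ^ i := by
    intro i j hij
    have : ((2 ^ i : ℕ) : F) = (2 ^ j : ℕ) := by push_cast; exact hij
    exact Nat.pow_right_injective le_rfl (Nat.cast_injective this)
  exact (D.eigenspaces_iSupIndep.comp h2).mono fun i x hx => Module.End.mem_eigenspace_iff.2 (h i x hx)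

theorem symAction_apply (V : FinMod F G) (g : G) (x : SymmetricAlgebra F V.carrier) :
    V.symAction g x = SymmetricAlgebra.map (V.ρ g) x := rfl

theorem cls_symPow (V : FinMod F G) (n : ℕ) :
    (V.symPow n).cls = subCls V.symAction (V.symComponent n) :=
  (subCls_eq _ _ (V.symComponent_le_comap n) (V.symPow n).finite).symm

theorem subCls_one {A : Type u} [Ring A] [Nontrivial A] [Algebra F A] {ρ : Representation F G A}
    (h1 : ∀ g, ρ g 1 = 1) : subCls ρ (1 : Submodule F A) = 1 := by
  rw [← FinMod.cls_triv, Submodule.one_eq_range]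
  refine subCls_range (ρ := ρ) FinMod.triv (Algebra.linearMap F A)
    (FaithfulSMul.algebraMap_injective F A) fun g (x : F) => ?_
  change algebraMap F A x = ρ g (algebraMap F A x)
  rw [Algebra.algebraMap_eq_smul_one, map_smul, h1]

theorem cls_symPow_zero (V : FinMod F G) : (V.symPow 0).cls = 1 := by
  rw [cls_symPow, FinMod.symComponent, pow_zero]
  exact subCls_one fun g => by rw [symAction_apply, map_one]

theorem cls_symPow_one (V : FinMod F G) : (V.symPow 1).cls = V.cls := by
  rw [cls_symPow, FinMod.symComponent, pow_one]
  exact subCls_range V _ SymmetricAlgebra.ι_injective fun g x => by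
    rw [symAction_apply, SymmetricAlgebra.map_ι]

theorem coeff_symSeries (V : FinMod F G) (n : ℕ) :
    PowerSeries.coeff n (V.symSeries : Ser F G) = (V.symPow n).cls := by
  rw [FinMod.symSeries, PowerSeries.coeff_mk]
  split_ifs with h
  · rw [h, cls_symPow_zero]
  · rfl

/-- Where multiplication is injective on a tensor product, a product of subspaces has the product
class. Equivariance is required only on `P` and `Q`, since the symmetrization map used later is
equivariant in one degree only. -/
theorem subCls_map_mul_map {A B C : Type u} [AddCommGroup A] [Module F A] [AddCommGroup B]
    [Module F B] [Ring C] [Algebra F C] {ρA : Representation F G A} {ρB : Representation F G B}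
    {ρC : Representation F G C} (hmul : ∀ g a b, ρC g (a * b) = ρC g a * ρC g b)
    (P : Submodule F A) (hP : ∀ g, P ≤ P.comap (ρA g)) (hPfin : FiniteDimensional F P)
    (Q : Submodule F B) (hQ : ∀ g, Q ≤ Q.comap (ρB g)) (hQfin : FiniteDimensional F Q)
    (f : A →ₗ[F] C) (f' : B →ₗ[F] C) (hf : ∀ g, ∀ x ∈ P, f (ρA g x) = ρC g (f x))
    (hf' : ∀ g, ∀ x ∈ Q, f' (ρB g x) = ρC g (f' x))
    (hinj : Function.Injective
      (LinearMap.mul' F C ∘ₗ TensorProduct.map (f ∘ₗ P.subtype) (f' ∘ₗ Q.subtype))) :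
    subCls ρC (P.map f * Q.map f') = subCls ρA P * subCls ρB Q := by
  rw [subCls_eq ρA P hP hPfin, subCls_eq ρB Q hQ hQfin]
  have h1 : P.map f = LinearMap.range (f ∘ₗ P.subtype) := by
    rw [LinearMap.range_comp, Submodule.range_subtype]
  have h2 : Q.map f' = LinearMap.range (f' ∘ₗ Q.subtype) := by
    rw [LinearMap.range_comp, Submodule.range_subtype]
  rw [h1, h2]
  exact subCls_range_mul hmul (FinMod.ofSub ρA P hP hPfin) (FinMod.ofSub ρB Q hQ hQfin) _ _
    (fun g (x : P) => hf g x x.2) (fun g (x : Q) => hf' g x x.2) hinj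

theorem algHom_pow_eigenvalue {A B : Type*} [Ring A] [Algebra F A] [Ring B] [Algebra F B]
    (D : B →ₐ[F] B) (f : A →ₐ[F] B) (c : F) (P : Submodule F A)
    (h : ∀ x ∈ P, D (f x) = c • f x) (n : ℕ) : ∀ x ∈ P ^ n, D (f x) = c ^ n • f x := by
  induction n with
  | zero =>
    intro x hx
    rw [pow_zero, Submodule.mem_one] at hx
    obtain ⟨a, rfl⟩ := hx
    simp
  | succ n ih =>
    intro x hx
    rw [pow_succ] at hx
    induction hx using Submodule.mul_induction_on' with
    | mem_mul_mem a ha b hb =>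
      rw [map_mul, map_mul, ih a ha, h b hb, smul_mul_smul_comm, pow_succ]
    | add a _ b _ ha hb => rw [map_add, map_add, ha, hb, smul_add]

/-- Inside `S(U ⊕ V)` the `n`-th component is the direct sum of the products `S^i(U) S^{n-i}(V)`,
each of which is a tensor product by `ofTensor_injective`. -/
theorem cls_symPow_sum [CharZero F] (U V : FinMod F G) (n : ℕ) :
    ((U.sum V).symPow n).cls =
      ∑ i ∈ Finset.range (n + 1), (U.symPow i).cls * (V.symPow (n - i)).cls := by
  set jU := SymmetricAlgebra.map (LinearMap.inl F U.carrier V.carrier)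
  set jV := SymmetricAlgebra.map (LinearMap.inr F U.carrier V.carrier)
  let τ : Representation F G (SymmetricAlgebra F (U.carrier × V.carrier)) := (U.sum V).symAction
  have hmul : ∀ g a b, τ g (a * b) = τ g a * τ g b := fun g a b =>
    map_mul (SymmetricAlgebra.map ((U.sum V).ρ g)) a b
  have heU : ∀ g x, jU (U.symAction g x) = τ g (jU x) := fun g x => by
    have : jU.comp (SymmetricAlgebra.map (U.ρ g)) =
        (SymmetricAlgebra.map ((U.ρ g).prodMap (V.ρ g))).comp jU := by
      apply SymmetricAlgebra.algHom_ext
      ext y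
      simp [jU]
    exact DFunLike.congr_fun this x
  have heV : ∀ g x, jV (V.symAction g x) = τ g (jV x) := fun g x => by
    have : jV.comp (SymmetricAlgebra.map (V.ρ g)) =
        (SymmetricAlgebra.map ((U.ρ g).prodMap (V.ρ g))).comp jV := by
      apply SymmetricAlgebra.algHom_ext
      ext y
      simp [jV]
    exact DFunLike.congr_fun this x
  have hfinU : ∀ i, FiniteDimensional F (U.symComponent i) := fun i => (U.symPow i).finite
  have hfinV : ∀ i, FiniteDimensional F (V.symComponent i) := fun i => (V.symPow i).finite
  have hcls : ∀ i j, subCls τ ((U.symComponent i).map jU.toLinearMap *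
      (V.symComponent j).map jV.toLinearMap) = (U.symPow i).cls * (V.symPow j).cls := fun i j => by
    rw [cls_symPow, cls_symPow]
    refine subCls_map_mul_map hmul _ (U.symComponent_le_comap i) (hfinU i) _
      (V.symComponent_le_comap j) (hfinV j) _ _ (fun g x _ => heU g x) (fun g x _ => heV g x) ?_
    have : LinearMap.mul' F _ ∘ₗ TensorProduct.map (jU.toLinearMap ∘ₗ (U.symComponent i).subtype)
        (jV.toLinearMap ∘ₗ (V.symComponent j).subtype) =
        SymmetricAlgebra.ofTensor.toLinearMap ∘ₗ
          TensorProduct.mapIncl (U.symComponent i) (V.symComponent j) := by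
      apply TensorProduct.ext'
      intro x y
      rfl
    rw [this, LinearMap.coe_comp]
    exact SymmetricAlgebra.ofTensor_injective.comp
      (TensorProduct.map_injective_of_flat_flat _ _ (Submodule.subtype_injective _)
        (Submodule.subtype_injective _))
  have hstab : ∀ i j g, (U.symComponent i).map jU.toLinearMap *
      (V.symComponent j).map jV.toLinearMap ≤ ((U.symComponent i).map jU.toLinearMap *
      (V.symComponent j).map jV.toLinearMap).comap (τ g) := fun i j g => by
    rw [Submodule.mul_le]
    rintro _ ⟨x, hx, rfl⟩ _ ⟨y, hy, rfl⟩
    rw [Submodule.mem_comap, hmul]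
    exact Submodule.mul_mem_mul ⟨U.symAction g x, U.symComponent_le_comap i g hx, heU g _⟩
      ⟨V.symAction g y, V.symComponent_le_comap j g hy, heV g _⟩
  have hfin : ∀ i j, FiniteDimensional F
      ((U.symComponent i).map jU.toLinearMap * (V.symComponent j).map jV.toLinearMap :
        Submodule F _) := fun i j =>
    .of_fg ((Submodule.FG.map _ ((Submodule.fg_iff_finiteDimensional _).2 (hfinU i))).mul
      (Submodule.FG.map _ ((Submodule.fg_iff_finiteDimensional _).2 (hfinV j))))
  have key : (U.sum V).symComponent n = ⨆ i ∈ Finset.range (n + 1),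
      (U.symComponent i).map jU.toLinearMap * (V.symComponent (n - i)).map jV.toLinearMap := by
    simp only [FinMod.symComponent, Submodule.map_pow]
    rw [← Submodule.sup_pow_of_commute (Commute.all _ _), ← SymmetricAlgebra.range_ι_prod]
    rfl
  rw [cls_symPow, key]
  refine (subCls_biSup (ρ := τ) _ _ (fun i _ => hstab i (n - i))
    (fun i _ => hfin i (n - i)) ?_).trans (Finset.sum_congr rfl fun i _ => hcls i (n - i))
  -- Doubling `U` and fixing `V` multiplies `S^i(U) S^{n-i}(V)` by `2^i`, which separates the
  -- summands.
  let D : SymmetricAlgebra F (U.carrier × V.carrier) →ₐ[F] _ := SymmetricAlgebra.map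
    ((LinearMap.lsmul F U.carrier (2 : F)).prodMap LinearMap.id)
  have hD : ∀ i, ∀ x ∈ (U.symComponent i).map jU.toLinearMap *
      (V.symComponent (n - i)).map jV.toLinearMap, D.toLinearMap x = (2 : F) ^ i • x := by
    intro i x hx
    induction hx using Submodule.mul_induction_on' with
    | mem_mul_mem x hx y hy =>
      obtain ⟨x, hx, rfl⟩ := hx
      obtain ⟨y, hy, rfl⟩ := hy
      have h1 := algHom_pow_eigenvalue D jU 2 _ (by
        rintro _ ⟨z, rfl⟩
        simp [D, jU, ← map_smul]) i x hx
      have h2 := algHom_pow_eigenvalue D jV 1 _ (by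
        rintro _ ⟨z, rfl⟩
        simp [D, jV]) _ y hy
      rw [one_pow, one_smul] at h2
      simp only [AlgHom.toLinearMap_apply] at h1 h2 ⊢
      rw [map_mul, h1, h2, smul_mul_assoc]
    | add a _ b _ ha hb => rw [map_add, ha, hb, smul_add]
  exact (iSupIndep_of_eigenvalue_two_pow D.toLinearMap _ hD).supIndep'  _

theorem symSeries_sum [CharZero F] (U V : FinMod F G) :
    ((U.sum V).symSeries : Ser F G) = U.symSeries * V.symSeries := by
  ext n
  rw [PowerSeries.coeff_mul, Finset.Nat.sum_antidiagonal_eq_sum_range_succ_mk, coeff_symSeries,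
    cls_symPow_sum]
  simp only [coeff_symSeries]

theorem symSeries_congr {U V : FinMod F G} (h : U ≈ V) :
    (U.symSeries : Ser F G) = V.symSeries := by
  obtain ⟨e, he⟩ : ∃ e : U.carrier ≃ₗ[F] V.carrier, ∀ g x, e (U.ρ g x) = V.ρ g (e x) :=
    h.elim fun e => ⟨e.toLinearEquiv,
      fun g x => Representation.IntertwiningMap.isIntertwining _ _ e.toIntertwiningMap g x⟩
  ext n
  rw [coeff_symSeries, coeff_symSeries]
  rw [cls_symPow, cls_symPow, ← subCls_map (U.symComponent n) (U.symComponent_le_comap n)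
    (U.symPow n).finite (SymmetricAlgebra.map e.toLinearMap).toLinearMap
    (τ := V.symAction)]
  · rw [FinMod.symComponent, FinMod.symComponent, Submodule.map_pow]
    congr 2
    apply le_antisymm
    · rintro _ ⟨_, ⟨x, rfl⟩, rfl⟩
      exact ⟨e x, by simp⟩
    · rintro _ ⟨x, rfl⟩
      exact ⟨_, ⟨e.symm x, rfl⟩, by simp⟩
  · intro x _ hx
    have h : (SymmetricAlgebra.map e.symm.toLinearMap).comp
        (SymmetricAlgebra.map e.toLinearMap) = AlgHom.id F _ := by
      apply SymmetricAlgebra.algHom_ext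
      ext y
      simp
    have h' := DFunLike.congr_fun h x
    rw [AlgHom.comp_apply] at h'
    rw [AlgHom.toLinearMap_apply] at hx
    rw [hx, map_zero] at h'
    exact h'.symm
  · intro g x _
    have h : (SymmetricAlgebra.map e.toLinearMap).comp
        (SymmetricAlgebra.map (U.ρ g)) = (SymmetricAlgebra.map (V.ρ g)).comp
          (SymmetricAlgebra.map e.toLinearMap) := by
      apply SymmetricAlgebra.algHom_ext
      ext y
      simpa using congrArg _ (he g y)
    exact DFunLike.congr_fun h x

theorem existsUnique_isPsi (F : Type u) [Field F] [CharZero F] (G : Type v) [Group G] :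
    ∃! ψ : Gam F G →ₗ[ℚ] TSer F G, IsPsi F G ψ := by
  let f : FinMod F G → TSer F G := fun V =>
    ⟨PowerSeries.logOf (V.symSeries : Ser F G), PowerSeries.constantCoeff_logOf V.symSeries.2⟩
  have hcongr : ∀ U V, U ≈ V → f U = f V := fun U V h =>
    Subtype.ext (congrArg PowerSeries.logOf (symSeries_congr h))
  have hsum : ∀ U V, f (U.sum V) = f U + f V := fun U V => Subtype.ext
    ((congrArg PowerSeries.logOf (symSeries_sum U V)).trans
      (PowerSeries.logOf_mul U.symSeries.2 V.symSeries.2))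
  obtain ⟨φ, hφ⟩ := exists_linearMap_of_additive f hcongr hsum
  refine ⟨φ, fun V => congrArg Subtype.val (hφ V), fun ψ hψ => ?_⟩
  refine Gam.linearMap_ext fun V => Subtype.ext ?_
  rw [hψ V, hφ V]

theorem psi_cls [CharZero F] (V : FinMod F G) :
    (psi F G V.cls : Ser F G) = PowerSeries.logOf (V.symSeries : Ser F G) :=
  Classical.epsilon_spec (existsUnique_isPsi F G).exists V

/-- Both sides are linear in `a`, and for a module the linear coefficient of `log S(V, t)` is
`S^1(V) = V`. This is what makes `S⁺` unitriangular. -/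
theorem coeff_one_psi [CharZero F] (a : Gam F G) :
    PowerSeries.coeff 1 (psi F G a : Ser F G) = a := by
  have : (PowerSeries.coeff (R := Gam F G) 1).restrictScalars ℚ ∘ₗ
      ((TSer F G).restrictScalars ℚ).subtype ∘ₗ psi F G = LinearMap.id := by
    refine Gam.linearMap_ext fun V => ?_
    change PowerSeries.coeff 1 (psi F G V.cls : Ser F G) = V.cls
    rw [psi_cls, PowerSeries.coeff_one_logOf V.symSeries.2, coeff_symSeries, cls_symPow_one]
  exact DFunLike.congr_fun this a

end GreenRingLie

/-! ### Polarization: spans of powers. -/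

section PowerSpan

variable {F : Type*} [Field F]

/-- A linear form vanishing on `W` but not at `w i` would give a nonzero polynomial in `t` that
vanishes on the infinite field `F`. -/
theorem Submodule.mem_of_forall_sum_pow_smul_mem [Infinite F] {X : Type*} [AddCommGroup X]
    [Module F X] (W : Submodule F X) (n : ℕ) (w : ℕ → X)
    (h : ∀ t : F, ∑ i ∈ Finset.range n, t ^ i • w i ∈ W) {i : ℕ} (hi : i < n) : w i ∈ W := by
  by_contra hw
  obtain ⟨φ, hφ, hW⟩ := Submodule.exists_le_ker_of_notMem hw
  have h0 : ∑ i ∈ Finset.range n, Polynomial.monomial i (φ (w i)) = 0 := by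
    refine Polynomial.funext fun t => ?_
    have := hW (h t)
    rw [LinearMap.mem_ker, map_sum] at this
    rw [Polynomial.eval_finsetSum, Polynomial.eval_zero, ← this]
    refine Finset.sum_congr rfl fun i _ => ?_
    rw [Polynomial.eval_monomial, map_smul, smul_eq_mul, mul_comm]
  have h1 := congrArg (Polynomial.coeff · i) h0
  simp only [Polynomial.finsetSum_coeff, Polynomial.coeff_monomial, Polynomial.coeff_zero] at h1
  rw [Finset.sum_ite_eq_of_mem' _ _ _ (Finset.mem_range.2 hi)] at h1
  exact hφ h1

variable {A : Type*} [Ring A] [Algebra F A]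

/-- This is the noncommutative expansion in powers of `t`, of which only the linear term is needed;
the other two clauses serve the induction and the case `n = 0`. -/
theorem exists_add_smul_pow_eq (x y : A) (n : ℕ) : ∃ w : ℕ → A,
    (∀ t : F, (x + t • y) ^ n = ∑ i ∈ Finset.range (n + 1), t ^ i • w i) ∧ w 0 = x ^ n ∧
      w 1 = ∑ i ∈ Finset.range n, x ^ i * y * x ^ (n - 1 - i) ∧ ∀ i, n < i → w i = 0 := by
  induction n with
  | zero =>
    refine ⟨fun i => if i = 0 then 1 else 0, fun t => by simp, by simp, by simp, fun i hi => ?_⟩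
    simp [hi.ne']
  | succ n ih =>
    obtain ⟨w, hw, h0, h1, h2⟩ := ih
    refine ⟨fun i => x * w i + if i = 0 then 0 else y * w (i - 1), fun t => ?_, ?_, ?_, ?_⟩
    · rw [pow_succ', hw, add_mul]
      simp only [smul_add, Finset.sum_add_distrib]
      congr 1
      · rw [Finset.sum_range_succ (n := n + 1), h2 (n + 1) n.lt_succ_self, mul_zero, smul_zero, add_zero,
          Finset.mul_sum]
        simp
      · rw [Finset.sum_range_succ' (n := n + 1), Finset.mul_sum]
        simp [pow_succ', smul_smul, mul_comm]
    · simp [h0, pow_succ']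
    · rw [Finset.sum_range_succ']
      simp only [h1, h0, one_ne_zero, if_false, Nat.sub_self, Finset.mul_sum]
      congr 1
      · refine Finset.sum_congr rfl fun i _ => ?_
        rw [pow_succ', show n + 1 - 1 - (i + 1) = n - 1 - i by omega]
        simp only [mul_assoc]
      · simp
    · intro i hi
      beta_reduce
      rw [h2 i (by omega), if_neg (by omega), h2 (i - 1) (by omega)]
      simp

/-- The span of the `n`-th powers of the elements of a subspace of an algebra. -/
def Submodule.powerSpan (M : Submodule F A) (n : ℕ) : Submodule F A :=
  Submodule.span F ((fun x => x ^ n) '' (M : Set A))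

theorem Submodule.pow_mem_powerSpan {M : Submodule F A} {x : A} (hx : x ∈ M) (n : ℕ) :
    x ^ n ∈ M.powerSpan n :=
  Submodule.subset_span ⟨x, hx, rfl⟩

theorem Submodule.powerSpan_le_pow (M : Submodule F A) (n : ℕ) : M.powerSpan n ≤ M ^ n := by
  rw [powerSpan, Submodule.span_le]
  rintro _ ⟨x, hx, rfl⟩
  exact Submodule.pow_mem_pow M hx n

theorem Submodule.powerSpan_zero (M : Submodule F A) : M.powerSpan 0 = 1 := by
  apply le_antisymm
  · simpa using M.powerSpan_le_pow 0
  · rw [Submodule.one_le]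
    simpa using M.pow_mem_powerSpan M.zero_mem 0

/-- The sum is the coefficient of `t` in `(x + t y)^n`, which lies in the span for every `t`. -/
theorem Submodule.sum_pow_mul_pow_mem_powerSpan [Infinite F] {M : Submodule F A} {x y : A}
    (hx : x ∈ M) (hy : y ∈ M) (n : ℕ) :
    ∑ i ∈ Finset.range n, x ^ i * y * x ^ (n - 1 - i) ∈ M.powerSpan n := by
  obtain ⟨w, hw, -, h1, h2⟩ := exists_add_smul_pow_eq (F := F) x y n
  rw [← h1]
  rcases Nat.eq_zero_or_pos n with rfl | hn
  · rw [h2 1 one_pos]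
    exact zero_mem _
  · refine Submodule.mem_of_forall_sum_pow_smul_mem _ (n + 1) w (fun t => ?_) (by omega)
    rw [← hw]
    exact pow_mem_powerSpan (add_mem hx (M.smul_mem t hy)) n

/-- In a commutative algebra the polarized power of order `n + 1` is `(n + 1) x^n y`, and `n + 1` is
invertible. -/
theorem Submodule.pow_eq_powerSpan {S : Type*} [CommRing S] [Algebra F S] [CharZero F]
    (M : Submodule F S) (n : ℕ) : M ^ n = M.powerSpan n := by
  refine le_antisymm ?_ (M.powerSpan_le_pow n)
  induction n with
  | zero => rw [powerSpan_zero, pow_zero]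
  | succ n ih =>
    rw [pow_succ]
    refine (mul_le_mul_left ih _).trans ?_
    rw [Submodule.mul_le]
    intro a ha y hy
    induction ha using Submodule.span_induction with
    | mem a ha =>
      obtain ⟨x, hx, rfl⟩ := ha
      have h := Submodule.sum_pow_mul_pow_mem_powerSpan (F := F) hx hy (n + 1)
      have h' : ∑ i ∈ Finset.range (n + 1), x ^ i * y * x ^ (n + 1 - 1 - i) =
          ((n + 1 : ℕ) : F) • (x ^ n * y) := by
        rw [Finset.sum_congr rfl (g := fun _ => x ^ n * y), Finset.sum_const, Finset.card_range,
          Nat.cast_smul_eq_nsmul]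
        intro i hi
        rw [Finset.mem_range] at hi
        rw [mul_right_comm, ← pow_add]
        congr 2
        omega
      rw [h'] at h
      exact (Submodule.smul_mem_iff _ (Nat.cast_ne_zero.2 n.succ_ne_zero)).1 h
    | zero => rw [zero_mul]; exact zero_mem _
    | add a b _ _ ha hb => rw [add_mul]; exact add_mem ha hb
    | smul c a _ ha => rw [smul_mul_assoc]; exact Submodule.smul_mem _ c ha

end PowerSpan

theorem Module.Basis.map_eq_sum_coord_smul {F M N κ : Type*} [CommSemiring F] [AddCommMonoid M]
    [Module F M] [AddCommMonoid N] [Module F N] [Fintype κ] (b : Module.Basis κ F M)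
    (j : M →ₗ[F] N) (x : M) : j x = ∑ i, b.coord i x • j (b i) := by
  conv_lhs => rw [← b.sum_repr x, map_sum]
  exact Finset.sum_congr rfl fun i _ => map_smul j _ _

/-! ### Derivations of the symmetric algebra and symmetrization. -/

namespace SymmetricAlgebra

variable {F M : Type*} [Field F] [AddCommGroup M] [Module F M]

/-- The homomorphism `a ↦ a + ∂(a) ε` into the dual numbers over `S(M)`, where `∂` is the derivation
of `S(M)` extending a linear form on `M`. -/
noncomputable def toDualNumber (l : Module.Dual F M) :
    SymmetricAlgebra F M →ₐ[F] TrivSqZeroExt (SymmetricAlgebra F M) (SymmetricAlgebra F M) :=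
  lift ((TrivSqZeroExt.inlAlgHom F _ _).toLinearMap ∘ₗ ι F M +
    ((TrivSqZeroExt.inrHom (SymmetricAlgebra F M) (SymmetricAlgebra F M)).restrictScalars F) ∘ₗ
      Algebra.linearMap F _ ∘ₗ l)

/-- The derivation of `S(M)` extending a linear form on `M`. -/
noncomputable def partialDeriv (l : Module.Dual F M) :
    SymmetricAlgebra F M →ₗ[F] SymmetricAlgebra F M :=
  ((TrivSqZeroExt.sndHom (SymmetricAlgebra F M) (SymmetricAlgebra F M)).restrictScalars F) ∘ₗ
    (toDualNumber l).toLinearMap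

theorem fst_toDualNumber (l : Module.Dual F M) (a : SymmetricAlgebra F M) :
    (toDualNumber l a).fst = a := by
  have : (TrivSqZeroExt.fstHom F _ _).comp (toDualNumber l) = AlgHom.id F _ := by
    apply algHom_ext
    ext x
    simp [toDualNumber]
  exact DFunLike.congr_fun this a

theorem partialDeriv_mul (l : Module.Dual F M) (a b : SymmetricAlgebra F M) :
    partialDeriv l (a * b) = a * partialDeriv l b + partialDeriv l a * b := by
  change (toDualNumber l (a * b)).snd = _
  rw [map_mul, TrivSqZeroExt.snd_mul, fst_toDualNumber, fst_toDualNumber, smul_eq_mul,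
    op_smul_eq_mul]
  rfl

theorem partialDeriv_ι (l : Module.Dual F M) (x : M) :
    partialDeriv l (ι F M x) = algebraMap F _ (l x) := by
  change (toDualNumber l (ι F M x)).snd = _
  rw [toDualNumber, lift_ι_apply]
  exact zero_add _

theorem partialDeriv_ι_pow (l : Module.Dual F M) (x : M) (n : ℕ) :
    partialDeriv l (ι F M x ^ (n + 1)) = (((n + 1 : ℕ) : F) * l x) • ι F M x ^ n := by
  induction n with
  | zero =>
    simp only [zero_add, pow_one, pow_zero, Nat.cast_one, one_mul, partialDeriv_ι,
      Algebra.algebraMap_eq_smul_one]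
  | succ n ih =>
    rw [pow_succ', partialDeriv_mul, ih, partialDeriv_ι, mul_smul_comm, ← pow_succ',
      ← Algebra.smul_def, ← add_smul]
    congr 1
    push_cast
    ring

theorem range_ι_pow_eq_span [CharZero F] (n : ℕ) : LinearMap.range (ι F M) ^ n =
    Submodule.span F (Set.range fun x => ι F M x ^ n) := by
  rw [Submodule.pow_eq_powerSpan, Submodule.powerSpan, LinearMap.coe_range, ← Set.range_comp]
  rfl

/-- Linear maps which agree on `n`-th powers agree on `S^n(M)`. -/
theorem eq_of_eq_on_powers [CharZero F] {X : Type*} [AddCommGroup X] [Module F X] {n : ℕ}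
    {f f' : SymmetricAlgebra F M →ₗ[F] X} (h : ∀ x, f (ι F M x ^ n) = f' (ι F M x ^ n))
    {s : SymmetricAlgebra F M} (hs : s ∈ LinearMap.range (ι F M) ^ n) : f s = f' s := by
  rw [range_ι_pow_eq_span] at hs
  refine LinearMap.eqOn_span (f := f) (g := f') ?_ hs
  rintro _ ⟨x, rfl⟩
  exact h x

theorem partialDeriv_mem [CharZero F] (l : Module.Dual F M) {n : ℕ} {s : SymmetricAlgebra F M}
    (hs : s ∈ LinearMap.range (ι F M) ^ (n + 1)) :
    partialDeriv l s ∈ LinearMap.range (ι F M) ^ n := by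
  rw [range_ι_pow_eq_span] at hs
  induction hs using Submodule.span_induction with
  | mem s hs =>
    obtain ⟨x, rfl⟩ := hs
    rw [partialDeriv_ι_pow]
    exact Submodule.smul_mem _ _ (Submodule.pow_mem_pow _ (LinearMap.mem_range_self _ x) n)
  | zero => rw [map_zero]; exact zero_mem _
  | add a b _ _ ha hb => rw [map_add]; exact add_mem ha hb
  | smul c a _ ha => rw [map_smul]; exact Submodule.smul_mem _ c ha

variable {A : Type*} [Ring A] [Algebra F A] {κ : Type*} [Fintype κ]

/-- The linear map on `S(M)` which sends `x ^ n` to `j(x) ^ n` for `x` in `M`, where `j` is a linear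
map from `M` to an associative algebra. -/
noncomputable def powMap (b : Module.Basis κ F M) (j : M →ₗ[F] A) :
    ℕ → SymmetricAlgebra F M →ₗ[F] A
  | 0 => Algebra.linearMap F A ∘ₗ algebraMapInv.toLinearMap
  -- Euler's identity dictates the recursion: at `x^{n+1}` the sum is `(n + 1) j(x) j(x)^n`. Going
  -- through derivations makes the map well defined from the outset, though it is meaningful only on
  -- `S^n(M)`.
  | n + 1 => ((n + 1 : ℕ) : F)⁻¹ • ∑ i, LinearMap.mulLeft F (j (b i)) ∘ₗ powMap b j n ∘ₗ
      partialDeriv (b.coord i)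

theorem powMap_ι_pow [CharZero F] (b : Module.Basis κ F M) (j : M →ₗ[F] A) (x : M) (n : ℕ) :
    powMap b j n (ι F M x ^ n) = j x ^ n := by
  induction n with
  | zero => simp [powMap]
  | succ n ih =>
    have hn : ((n + 1 : ℕ) : F) ≠ 0 := Nat.cast_ne_zero.2 n.succ_ne_zero
    have hx := b.map_eq_sum_coord_smul (j) x
    rw [powMap, LinearMap.smul_apply, LinearMap.sum_apply]
    simp only [LinearMap.comp_apply, partialDeriv_ι_pow, map_smul, ih, LinearMap.mulLeft_apply,
      mul_smul, ← Finset.smul_sum]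
    rw [inv_smul_smul₀ hn, pow_succ' (j x), hx, Finset.sum_mul, ← hx]
    simp only [smul_mul_assoc]

/-- The Euler identity in `S^n(M)`. -/
theorem sum_ι_mul_partialDeriv [CharZero F] (b : Module.Basis κ F M) (n : ℕ)
    {s : SymmetricAlgebra F M} (hs : s ∈ LinearMap.range (ι F M) ^ (n + 1)) :
    ∑ i, ι F M (b i) * partialDeriv (b.coord i) s = ((n + 1 : ℕ) : F) • s := by
  have := eq_of_eq_on_powers (n := n + 1)
    (f := ∑ i, LinearMap.mulLeft F (ι F M (b i)) ∘ₗ partialDeriv (b.coord i))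
    (f' := ((n + 1 : ℕ) : F) • LinearMap.id) (fun x => ?_) hs
  · simpa using this
  · have hx := b.map_eq_sum_coord_smul (ι F M) x
    simp only [LinearMap.sum_apply, LinearMap.comp_apply, partialDeriv_ι_pow, map_smul,
      LinearMap.mulLeft_apply, mul_smul, ← Finset.smul_sum, LinearMap.smul_apply, LinearMap.id_apply]
    congr 1
    rw [pow_succ', hx, Finset.sum_mul, ← hx]
    simp only [smul_mul_assoc]

theorem map_powMap [CharZero F] (b : Module.Basis κ F M) (j : M →ₗ[F] A) (n : ℕ) :
    (LinearMap.range (ι F M) ^ n).map (powMap b j n) = (LinearMap.range j).powerSpan n := by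
  rw [range_ι_pow_eq_span, Submodule.map_span, ← Set.range_comp, Submodule.powerSpan,
    LinearMap.coe_range, ← Set.range_comp]
  congr 2
  ext x
  exact powMap_ι_pow b j x n

/-- If there are operators on `A` which act on the products `j(x) ^ n * c` like differentiation with
respect to `x`, then multiplication `S^n(M) ⊗ C → A` is injective. -/
theorem mul'_powMap_injective [CharZero F] (b : Module.Basis κ F M) (j : M →ₗ[F] A)
    (C : Submodule F A) (D : Module.Dual F M → A →ₗ[F] A)
    (hD : ∀ l x n, ∀ c ∈ C, D l (j x ^ (n + 1) * c) = (((n + 1 : ℕ) : F) * l x) • (j x ^ n * c))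
    (n : ℕ) :
    Function.Injective (LinearMap.mul' F A ∘ₗ TensorProduct.map
      (powMap b j n ∘ₗ (LinearMap.range (ι F M) ^ n).subtype) C.subtype) := by
  induction n with
  | zero =>
    rw [injective_iff_map_eq_zero]
    intro t ht
    have h1 : ∃ c : C, t = (⟨1, by rw [pow_zero]; exact Submodule.one_le.1 le_rfl⟩ :
        (LinearMap.range (ι F M) ^ 0 : Submodule F (SymmetricAlgebra F M))) ⊗ₜ c := by
      clear ht
      induction t using TensorProduct.induction_on with
      | zero => exact ⟨0, by rw [TensorProduct.tmul_zero]⟩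
      | tmul s c =>
        obtain ⟨s, hs⟩ := s
        have hs' := hs
        rw [pow_zero, Submodule.mem_one] at hs'
        obtain ⟨r, rfl⟩ := hs'
        refine ⟨r • c, ?_⟩
        rw [← TensorProduct.smul_tmul]
        congr 1
        exact Subtype.ext (Algebra.algebraMap_eq_smul_one r)
      | add s t hs ht =>
        obtain ⟨c, rfl⟩ := hs
        obtain ⟨d, rfl⟩ := ht
        exact ⟨c + d, by rw [TensorProduct.tmul_add]⟩
    obtain ⟨c, rfl⟩ := h1
    have hc : c = 0 := by
      apply Subtype.ext
      simpa [powMap] using ht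
    rw [hc, TensorProduct.tmul_zero]
  | succ n ih =>
    rw [injective_iff_map_eq_zero]
    intro t ht
    let d : Module.Dual F M → (LinearMap.range (ι F M) ^ (n + 1) : Submodule F _) →ₗ[F]
        (LinearMap.range (ι F M) ^ n : Submodule F _) := fun l =>
      (partialDeriv l).restrict fun s hs => partialDeriv_mem l hs
    let m : κ → (LinearMap.range (ι F M) ^ n : Submodule F _) →ₗ[F]
        (LinearMap.range (ι F M) ^ (n + 1) : Submodule F _) := fun i =>
      (LinearMap.mulLeft F (ι F M (b i))).restrict fun s hs => by
        rw [pow_succ']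
        exact Submodule.mul_mem_mul ⟨_, rfl⟩ hs
    -- `D l` carries the product map in order `n + 1` to the product map in order `n` after `∂_l`,
    -- so each `∂_l t` is in the kernel in order `n` and vanishes by induction.
    have hd : ∀ l, TensorProduct.map (d l) (LinearMap.id (M := C)) t = 0 := by
      intro l
      apply (injective_iff_map_eq_zero _).1 ih
      have : (LinearMap.mul' F A ∘ₗ TensorProduct.map
          (powMap b j n ∘ₗ (LinearMap.range (ι F M) ^ n).subtype) C.subtype) ∘ₗ
          TensorProduct.map (d l) (LinearMap.id (M := C)) =
          D l ∘ₗ LinearMap.mul' F A ∘ₗ TensorProduct.map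
            (powMap b j (n + 1) ∘ₗ (LinearMap.range (ι F M) ^ (n + 1)).subtype) C.subtype := by
        apply TensorProduct.ext'
        rintro ⟨s, hs⟩ ⟨c, hc⟩
        change powMap b j n (partialDeriv l s) * c = D l (powMap b j (n + 1) s * c)
        refine eq_of_eq_on_powers (f := LinearMap.mulRight F c ∘ₗ powMap b j n ∘ₗ partialDeriv l)
          (f' := D l ∘ₗ LinearMap.mulRight F c ∘ₗ powMap b j (n + 1)) (fun x => ?_) hs
        simp only [LinearMap.comp_apply, LinearMap.mulRight_apply, powMap_ι_pow, hD l x n c hc,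
          partialDeriv_ι_pow, map_smul]
      rw [← LinearMap.comp_apply, this, LinearMap.comp_apply, ht, map_zero]
    -- Euler's identity recovers `(n + 1) t` from the partial derivatives of `t`.
    have hm : ∑ i, TensorProduct.map (m i) (LinearMap.id (M := C)) ∘ₗ
        TensorProduct.map (d (b.coord i)) LinearMap.id =
        ((n + 1 : ℕ) : F) • LinearMap.id := by
      apply TensorProduct.ext'
      rintro ⟨s, hs⟩ c
      simp only [LinearMap.sum_apply, LinearMap.comp_apply, TensorProduct.map_tmul,
        LinearMap.id_apply, LinearMap.smul_apply, ← TensorProduct.sum_tmul,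
        TensorProduct.smul_tmul']
      congr 1
      apply Subtype.ext
      rw [AddSubmonoidClass.coe_finsetSum]
      exact sum_ι_mul_partialDeriv b n hs
    have h0 := LinearMap.congr_fun hm t
    simp only [LinearMap.sum_apply, LinearMap.comp_apply, hd, map_zero, Finset.sum_const_zero,
      LinearMap.smul_apply, LinearMap.id_apply] at h0
    exact (smul_eq_zero.1 h0.symm).resolve_left (Nat.cast_ne_zero.2 n.succ_ne_zero)

/-- Under the same hypothesis, there is an analogue of the Euler operator. -/
theorem exists_end_powerSpan_mul (b : Module.Basis κ F M) (j : M →ₗ[F] A)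
    (C : Submodule F A) (D : Module.Dual F M → A →ₗ[F] A)
    (hD : ∀ l x n, ∀ c ∈ C, D l (j x ^ (n + 1) * c) = (((n + 1 : ℕ) : F) * l x) • (j x ^ n * c))
    (hD0 : ∀ l, ∀ c ∈ C, D l c = 0) :
    ∃ E : Module.End F A, ∀ n, ∀ x ∈ (LinearMap.range j).powerSpan n * C, E x = (n : F) • x := by
  let E : Module.End F A := ∑ i, LinearMap.mulLeft F (j (b i)) ∘ₗ D (b.coord i)
  refine ⟨E, fun n => ?_⟩
  suffices (LinearMap.range j).powerSpan n * C ≤ E.eigenspace (n : F) from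
    fun x hx => Module.End.mem_eigenspace_iff.1 (this hx)
  rw [Submodule.mul_le]
  intro a ha c hc
  rw [Module.End.mem_eigenspace_iff]
  induction ha using Submodule.span_induction with
  | mem a ha =>
    obtain ⟨_, ⟨x, rfl⟩, rfl⟩ := ha
    have hx := b.map_eq_sum_coord_smul (j) x
    cases n with
    | zero => simp [E, hD0 _ c hc]
    | succ n =>
      simp only [E, LinearMap.sum_apply, LinearMap.comp_apply, hD _ _ _ c hc, map_smul,
        LinearMap.mulLeft_apply, mul_smul, ← Finset.smul_sum]
      congr 1
      rw [pow_succ', mul_assoc, hx, Finset.sum_mul, ← hx]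
      simp only [smul_mul_assoc]
  | zero => simp
  | add a b _ _ ha hb => rw [add_mul, map_add, ha, hb, smul_add]
  | smul r a _ ha => rw [smul_mul_assoc, map_smul, ha, smul_comm]

end SymmetricAlgebra

/-! ### The tensor algebra: grading, comultiplication and Lie powers. -/

namespace TensorAlgebra

section Lie

attribute [local instance] LieRing.ofAssociativeRing

variable {F V : Type*} [Field F] [AddCommGroup V] [Module F V]

variable (F V) in
/-- The homogeneous component `T^n(V)`. -/
abbrev deg (n : ℕ) : Submodule F (TensorAlgebra F V) :=
  LinearMap.range (ι F : V →ₗ[F] TensorAlgebra F V) ^ n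

theorem iSup_deg : ⨆ n, deg F V n = ⊤ :=
  (DirectSum.Decomposition.isInternal (deg F V)).submodule_iSup_eq_top

variable (F V) in
/-- The projection onto `T^n(V)`. -/
noncomputable def degProj (n : ℕ) : TensorAlgebra F V →ₗ[F] TensorAlgebra F V :=
  GradedAlgebra.proj (deg F V) n

theorem degProj_of_mem {n : ℕ} {x : TensorAlgebra F V} (hx : x ∈ deg F V n) :
    degProj F V n x = x :=
  DirectSum.decompose_of_mem_same _ hx

theorem degProj_of_mem_ne {m n : ℕ} {x : TensorAlgebra F V} (hx : x ∈ deg F V m) (h : m ≠ n) :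
    degProj F V n x = 0 :=
  DirectSum.decompose_of_mem_ne _ hx h

theorem mul_mem_deg {m n : ℕ} {x y : TensorAlgebra F V} (hx : x ∈ deg F V m)
    (hy : y ∈ deg F V n) : x * y ∈ deg F V (m + n) := by
  rw [deg, pow_add]
  exact Submodule.mul_mem_mul hx hy

theorem algebraMapInv_of_mem_deg {n : ℕ} (hn : n ≠ 0) {x : TensorAlgebra F V}
    (hx : x ∈ deg F V n) : algebraMapInv x = 0 := by
  obtain ⟨n, rfl⟩ := Nat.exists_eq_succ_of_ne_zero hn
  rw [deg, pow_succ'] at hx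
  induction hx using Submodule.mul_induction_on' with
  | mem_mul_mem x hx y hy =>
    obtain ⟨v, rfl⟩ := hx
    simp [algebraMapInv]
  | add x _ y _ hx hy => rw [map_add, hx, hy, add_zero]

/-! ### The comultiplication -/

variable (F V) in
/-- The comultiplication of `T(V)` for which the elements of `V` are primitive. -/
noncomputable def comul : TensorAlgebra F V →ₐ[F] TensorAlgebra F V ⊗[F] TensorAlgebra F V :=
  lift F (Algebra.TensorProduct.includeLeft.toLinearMap ∘ₗ ι F +
    Algebra.TensorProduct.includeRight.toLinearMap ∘ₗ ι F)

theorem comul_ι (v : V) : comul F V (ι F v) = ι F v ⊗ₜ 1 + 1 ⊗ₜ ι F v := by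
  simp [comul]

theorem lid_counit_comul (a : TensorAlgebra F V) :
    TensorProduct.lid F _ (LinearMap.rTensor _ algebraMapInv.toLinearMap (comul F V a)) = a := by
  have : (Algebra.TensorProduct.lid F (TensorAlgebra F V)).toAlgHom.comp
      ((Algebra.TensorProduct.map algebraMapInv (AlgHom.id F _)).comp (comul F V)) =
      AlgHom.id F _ := by
    ext v
    simp [comul_ι, algebraMapInv]
  exact DFunLike.congr_fun this a

/-- Primitive elements are closed under commutators. -/
theorem comul_of_mem_lieSpan {x : TensorAlgebra F V}
    (hx : x ∈ LieSubalgebra.lieSpan F (TensorAlgebra F V) (Set.range (ι F : V →ₗ[F] _))) :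
    comul F V x = x ⊗ₜ 1 + 1 ⊗ₜ x := by
  induction hx using LieSubalgebra.lieSpan_induction with
  | mem x hx => obtain ⟨v, rfl⟩ := hx; exact comul_ι v
  | zero => simp
  | smul c x _ hx => rw [map_smul, hx, smul_add, TensorProduct.smul_tmul', TensorProduct.tmul_smul]
  | add x y _ _ hx hy => rw [map_add, hx, hy, TensorProduct.add_tmul, TensorProduct.tmul_add]; abel
  | lie x y _ _ hx hy =>
    rw [Ring.lie_def, map_sub, map_mul, map_mul, hx, hy]
    simp only [mul_add, add_mul, Algebra.TensorProduct.tmul_mul_tmul, one_mul, mul_one,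
      TensorProduct.sub_tmul, TensorProduct.tmul_sub]
    abel

/-- The operator `(l ⊗ 1) ∘ Δ` for a linear form `l`. -/
noncomputable def contract (l : TensorAlgebra F V →ₗ[F] F) :
    TensorAlgebra F V →ₗ[F] TensorAlgebra F V :=
  (TensorProduct.lid F _).toLinearMap ∘ₗ LinearMap.rTensor _ l ∘ₗ (comul F V).toLinearMap

/-- Since `Δ(x a) = (x ⊗ 1 + 1 ⊗ x) Δ(a)`, the first summand gives `l(x) a` by `hl` and the counit
law, the second `x` times the contraction of `a`. -/
theorem contract_mul {l : TensorAlgebra F V →ₗ[F] F} {x : TensorAlgebra F V}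
    (hx : comul F V x = x ⊗ₜ 1 + 1 ⊗ₜ x) (hl : ∀ a, l (x * a) = l x * algebraMapInv a)
    (a : TensorAlgebra F V) : contract l (x * a) = l x • a + x * contract l a := by
  have h1 : ∀ t : TensorAlgebra F V ⊗[F] TensorAlgebra F V,
      TensorProduct.lid F _ (LinearMap.rTensor _ l ((x ⊗ₜ 1) * t)) =
        l x • TensorProduct.lid F _ (LinearMap.rTensor _ algebraMapInv.toLinearMap t) := by
    intro t
    induction t using TensorProduct.induction_on with
    | zero => simp
    | tmul b c => simp [hl, mul_smul]
    | add s t hs ht => rw [mul_add, map_add, map_add, hs, ht, map_add, map_add, smul_add]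
  have h2 : ∀ t : TensorAlgebra F V ⊗[F] TensorAlgebra F V,
      TensorProduct.lid F _ (LinearMap.rTensor _ l ((1 ⊗ₜ x) * t)) =
        x * TensorProduct.lid F _ (LinearMap.rTensor _ l t) := by
    intro t
    induction t using TensorProduct.induction_on with
    | zero => simp
    | tmul b c => simp
    | add s t hs ht => rw [mul_add, map_add, map_add, hs, ht, map_add, map_add, mul_add]
  change TensorProduct.lid F _ (LinearMap.rTensor _ l (comul F V (x * a))) = _
  rw [map_mul, hx, add_mul, map_add, map_add, h1, h2, lid_counit_comul]
  rfl

theorem contract_one {l : TensorAlgebra F V →ₗ[F] F} (hl : l 1 = 0) : contract l 1 = 0 := by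
  simp [contract, Algebra.TensorProduct.one_def, hl]

/-! ### The Lie powers -/

variable (F V) in
/-- The `n`-th Lie power `T^n(V) ∩ L(V)`. -/
noncomputable abbrev lieDeg (n : ℕ) : Submodule F (TensorAlgebra F V) :=
  deg F V n ⊓ (LieSubalgebra.lieSpan F (TensorAlgebra F V)
    (Set.range (ι F : V →ₗ[F] TensorAlgebra F V))).toSubmodule

theorem commutator_mem_lieDeg {m n : ℕ} {x y : TensorAlgebra F V} (hx : x ∈ lieDeg F V m)
    (hy : y ∈ lieDeg F V n) : x * y - y * x ∈ lieDeg F V (m + n) := by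
  refine ⟨sub_mem (mul_mem_deg hx.1 hy.1) (add_comm n m ▸ mul_mem_deg hy.1 hx.1), ?_⟩
  exact LieSubalgebra.lie_mem _ hx.2 hy.2

variable (F V) in
/-- The subalgebra of `T(V)` generated by the Lie powers of degree at least `k`. -/
noncomputable def lieTail (k : ℕ) : Subalgebra F (TensorAlgebra F V) :=
  Algebra.adjoin F {x | ∃ n, k ≤ n ∧ x ∈ lieDeg F V n}

theorem mem_lieTail {k n : ℕ} (h : k ≤ n) {x : TensorAlgebra F V} (hx : x ∈ lieDeg F V n) :
    x ∈ lieTail F V k :=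
  Algebra.subset_adjoin ⟨n, h, hx⟩

theorem lieTail_one : lieTail F V 1 = ⊤ := by
  rw [eq_top_iff, ← adjoin_range_ι]
  refine Algebra.adjoin_mono ?_
  rintro _ ⟨v, rfl⟩
  refine ⟨1, le_rfl, ?_, LieSubalgebra.subset_lieSpan ⟨v, rfl⟩⟩
  rw [deg, pow_one]
  exact ⟨v, rfl⟩

theorem lieTail_anti {k l : ℕ} (h : k ≤ l) : lieTail F V l ≤ lieTail F V k :=
  Algebra.adjoin_mono fun _ ⟨n, hn, hx⟩ => ⟨n, h.trans hn, hx⟩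

/-- An operator on `T(V)` which acts like differentiation on the products of powers of elements of
`L^k(V)` with elements of the subalgebra generated by the Lie powers of higher degree. -/
theorem exists_derivative {k : ℕ} (hk : k ≠ 0) (l : Module.Dual F (lieDeg F V k)) :
    ∃ D : TensorAlgebra F V →ₗ[F] TensorAlgebra F V,
      (∀ (x : lieDeg F V k) (n : ℕ), ∀ c ∈ lieTail F V (k + 1),
        D (((lieDeg F V k).subtype x) ^ (n + 1) * c) =
          (((n + 1 : ℕ) : F) * l x) • ((lieDeg F V k).subtype x ^ n * c)) ∧
      ∀ c ∈ lieTail F V (k + 1), D c = 0 := by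
  obtain ⟨l', hl'⟩ := LinearMap.exists_extend l
  have hl' : ∀ x : lieDeg F V k, l' x = l x := fun x => DFunLike.congr_fun hl' x
  -- The form `l` is extended to `T(V)` so as to vanish outside degree `k`; the operator sought is
  -- `(μ ⊗ 1) ∘ Δ`.
  let μ : TensorAlgebra F V →ₗ[F] F := l' ∘ₗ degProj F V k
  have hμ0 : ∀ {m : ℕ}, m ≠ k → ∀ x ∈ deg F V m, μ x = 0 := fun hm x hx => by
    simp only [μ, LinearMap.comp_apply, degProj_of_mem_ne hx hm, map_zero]
  have hμ : ∀ x : lieDeg F V k, μ x = l x := fun x => by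
    simp only [μ, LinearMap.comp_apply, degProj_of_mem x.2.1, hl']
  -- For `a` of positive degree, `x a` has degree above `k`, so both sides vanish; only the scalar
  -- part of `a` counts.
  have hmul : ∀ {n : ℕ}, k ≤ n → ∀ x ∈ deg F V n, ∀ a, μ (x * a) = μ x * algebraMapInv a := by
    intro n hn x hx a
    have ha : a ∈ ⨆ m, deg F V m := by rw [iSup_deg]; trivial
    induction ha using Submodule.iSup_induction' with
    | mem m a ha =>
      rcases eq_or_ne m 0 with rfl | hm
      · rw [deg, pow_zero, Submodule.mem_one] at ha
        obtain ⟨c, rfl⟩ := ha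
        rw [algebraMap_leftInverse V c, ← Algebra.commutes, ← Algebra.smul_def, map_smul,
          smul_eq_mul, mul_comm]
      · rw [algebraMapInv_of_mem_deg hm ha, mul_zero, hμ0 (by omega) _ (mul_mem_deg hx ha)]
    | zero => simp
    | add a b _ _ ha hb => rw [mul_add, map_add, ha, hb, map_add, mul_add]
  have hstep : ∀ {n : ℕ}, k ≤ n → ∀ x ∈ lieDeg F V n, ∀ a,
      contract μ (x * a) = μ x • a + x * contract μ a := fun hn x hx a =>
    contract_mul (comul_of_mem_lieSpan hx.2) (hmul hn x hx.1) a
  -- `μ` vanishes on the generators, whose degrees exceed `k`; so elements of the tail behave as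
  -- constants.
  have hB : ∀ c ∈ lieTail F V (k + 1), ∀ a, contract μ (c * a) = c * contract μ a := by
    intro c hc
    induction hc using Algebra.adjoin_induction with
    | mem c hc =>
      obtain ⟨n, hn, hc⟩ := hc
      intro a
      rw [hstep (by omega) c hc, hμ0 (by omega) c hc.1, zero_smul, zero_add]
    | algebraMap r =>
      intro a
      rw [← Algebra.smul_def, map_smul, Algebra.smul_def]
    | add c d _ _ hc hd => intro a; rw [add_mul, map_add, hc, hd, add_mul]
    | mul c d _ _ hc hd => intro a; rw [mul_assoc, hc, hd, mul_assoc]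
  have h1 : contract μ 1 = 0 :=
    contract_one (hμ0 hk.symm 1 (by rw [deg, pow_zero]; exact Submodule.one_le.1 le_rfl))
  have hB0 : ∀ c ∈ lieTail F V (k + 1), contract μ c = 0 := fun c hc => by
    simpa [h1] using hB c hc 1
  refine ⟨contract μ, fun x n c hc => ?_, hB0⟩
  induction n with
  | zero =>
    rw [zero_add, pow_one, Submodule.subtype_apply, hstep le_rfl _ x.2, hB0 c hc, hμ]
    simp
  | succ n ih =>
    rw [pow_succ', mul_assoc, Submodule.subtype_apply, hstep le_rfl _ x.2]
    rw [Submodule.subtype_apply] at ih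
    rw [ih, hμ, mul_smul_comm, ← mul_assoc, ← pow_succ', ← add_smul]
    congr 1
    push_cast
    ring

/-! ### Elimination of the Lie power of lowest degree -/

/-- The commutator with `x` is a derivation and sends each generator to a Lie element of degree at
least `k + 1`. -/
theorem commutator_mem_lieTail {k : ℕ} {x b : TensorAlgebra F V} (hx : x ∈ lieDeg F V k)
    (hb : b ∈ lieTail F V (k + 1)) : b * x - x * b ∈ lieTail F V (k + 1) := by
  induction hb using Algebra.adjoin_induction with
  | mem b hb =>
    obtain ⟨n, hn, hb⟩ := hb
    exact mem_lieTail (by omega) (commutator_mem_lieDeg hb hx)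
  | algebraMap r => rw [Algebra.commutes, sub_self]; exact zero_mem _
  | add b c _ _ hb hc => convert add_mem hb hc using 1; noncomm_ring
  | mul b c hb' hc' hb hc =>
    have h : b * c * x - x * (b * c) = b * (c * x - x * c) + (b * x - x * b) * c := by
      noncomm_ring
    rw [h]
    exact add_mem (mul_mem hb' hc) (mul_mem hb hc')

variable (F V) in
/-- The subspace of `T(V)` spanned by `1` and `L^k(V)`. -/
noncomputable def lieDegOne (k : ℕ) : Submodule F (TensorAlgebra F V) := lieDeg F V k ⊔ 1

/-- Moving a tail element to the right past `x` creates a commutator with one factor `x` fewer; the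
summand `1` in `lieDegOne` makes room for it. -/
theorem tail_mul_pow_le (k n : ℕ) : (lieTail F V (k + 1)).toSubmodule * lieDegOne F V k ^ n ≤
    lieDegOne F V k ^ n * (lieTail F V (k + 1)).toSubmodule := by
  have h1 : (lieTail F V (k + 1)).toSubmodule * lieDegOne F V k ≤
      lieDegOne F V k * (lieTail F V (k + 1)).toSubmodule := by
    rw [lieDegOne, Submodule.mul_sup, mul_one, sup_le_iff]
    constructor
    · rw [Submodule.mul_le]
      intro b hb x hx
      have : b * x = x * b + 1 * (b * x - x * b) := by noncomm_ring
      rw [this]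
      exact add_mem (Submodule.mul_mem_mul (Submodule.mem_sup_left hx) hb)
        (Submodule.mul_mem_mul (Submodule.mem_sup_right (Submodule.one_le.1 le_rfl))
          (commutator_mem_lieTail hx hb))
    · exact (one_mul _).symm.le.trans (mul_le_mul_left le_sup_right _)
  induction n with
  | zero => rw [pow_zero, one_mul, mul_one]
  | succ n ih =>
    rw [pow_succ, ← mul_assoc]
    refine (mul_le_mul_left ih _).trans ?_
    rw [mul_assoc, mul_assoc]
    exact mul_le_mul_right h1 _

theorem tail_mul_pow_mul_le (k n : ℕ) :
    (lieTail F V (k + 1)).toSubmodule * (lieDegOne F V k ^ n * (lieTail F V (k + 1)).toSubmodule) ≤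
      lieDegOne F V k ^ n * (lieTail F V (k + 1)).toSubmodule := by
  rw [← mul_assoc]
  refine (mul_le_mul_left (tail_mul_pow_le k n) _).trans ?_
  rw [mul_assoc, (Subalgebra.isIdempotentElem_toSubmodule _).eq]

/-- The commutator of `x` and `y` has degree `2k ≥ k + 1`, hence lies in the tail; reordering thus
costs two factors from `L^k(V)`. -/
theorem pow_commutator_mem {k : ℕ} (hk : k ≠ 0) {x y : TensorAlgebra F V} (hx : x ∈ lieDeg F V k)
    (hy : y ∈ lieDeg F V k) (m : ℕ) : x ^ (m + 1) * y - y * x ^ (m + 1) ∈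
      lieDegOne F V k ^ m * (lieTail F V (k + 1)).toSubmodule := by
  have hxy : x * y - y * x ∈ lieTail F V (k + 1) :=
    mem_lieTail (by omega) (commutator_mem_lieDeg hx hy)
  have hx' : x ∈ lieDegOne F V k := Submodule.mem_sup_left hx
  induction m with
  | zero =>
    simpa using hxy
  | succ m ih =>
    have : x ^ (m + 1 + 1) * y - y * x ^ (m + 1 + 1) =
        x * (x ^ (m + 1) * y - y * x ^ (m + 1)) + (x * y - y * x) * x ^ (m + 1) := by
      rw [pow_succ' x (m + 1)]
      noncomm_ring
    rw [this]
    refine add_mem ?_ (tail_mul_pow_le k (m + 1)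
      (Submodule.mul_mem_mul hxy (Submodule.pow_mem_pow _ hx' _)))
    rw [pow_succ', mul_assoc]
    exact Submodule.mul_mem_mul hx' ih

variable (F V) in
/-- The sum of the products of powers of order at most `n` of elements of `L^k(V)` with elements of
the subalgebra generated by the Lie powers of higher degree. -/
noncomputable def powFiltration (k n : ℕ) : Submodule F (TensorAlgebra F V) :=
  ⨆ i ∈ Finset.range (n + 1), (lieDeg F V k).powerSpan i * (lieTail F V (k + 1)).toSubmodule

theorem le_powFiltration (k : ℕ) {i n : ℕ} (h : i ≤ n) :
    (lieDeg F V k).powerSpan i * (lieTail F V (k + 1)).toSubmodule ≤ powFiltration F V k n :=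
  le_iSup₂_of_le i (Finset.mem_range.2 (Nat.lt_succ_of_le h)) le_rfl

theorem powFiltration_mono (k : ℕ) {m n : ℕ} (h : m ≤ n) :
    powFiltration F V k m ≤ powFiltration F V k n :=
  iSup₂_le fun i hi => le_powFiltration k (by have := Finset.mem_range.1 hi; omega)

theorem pow_mono_lieDegOne (k : ℕ) {m n : ℕ} (h : m ≤ n) :
    lieDegOne F V k ^ m ≤ lieDegOne F V k ^ n :=
  pow_le_pow_right' le_sup_right h

/-- Up to terms of order at most `i`, every `x^m y x^{i-m}` equals `y x^i`. Their sum over `m` is a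
polarized power, and the factor `i + 1` is invertible. -/
theorem mul_pow_mem_powFiltration [CharZero F] {k : ℕ} (hk : k ≠ 0) {i : ℕ}
    (ih : lieDegOne F V k ^ i * (lieTail F V (k + 1)).toSubmodule ≤ powFiltration F V k i)
    {x y b : TensorAlgebra F V} (hx : x ∈ lieDeg F V k) (hy : y ∈ lieDeg F V k)
    (hb : b ∈ lieTail F V (k + 1)) : y * x ^ i * b ∈ powFiltration F V k (i + 1) := by
  have h := Submodule.sum_pow_mul_pow_mem_powerSpan (F := F) hx hy (i + 1)
  have h' : ∑ m ∈ Finset.range (i + 1), (x ^ m * y * x ^ (i + 1 - 1 - m) - y * x ^ i) ∈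
      lieDegOne F V k ^ i * (lieTail F V (k + 1)).toSubmodule := by
    refine Submodule.sum_mem _ fun m hm => ?_
    have hm := Finset.mem_range.1 hm
    rcases m with _ | m
    · simp
    · have h1 : x ^ (m + 1) * y * x ^ (i + 1 - 1 - (m + 1)) - y * x ^ i =
          (x ^ (m + 1) * y - y * x ^ (m + 1)) * x ^ (i - (m + 1)) := by
        have : x ^ i = x ^ (m + 1) * x ^ (i - (m + 1)) := by
          rw [← pow_add]; congr 1; omega
        rw [sub_mul, this, show i + 1 - 1 - (m + 1) = i - (m + 1) by omega, mul_assoc y]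
      rw [h1]
      have h2 := Submodule.mul_mem_mul (pow_commutator_mem hk hx hy m)
        (Submodule.pow_mem_pow (lieDegOne F V k) (Submodule.mem_sup_left hx) (i - (m + 1)))
      rw [mul_assoc] at h2
      -- The tail factor is moved to the right of the remaining powers of `x`.
      have h3 := mul_le_mul_right (tail_mul_pow_le (F := F) (V := V) k (i - (m + 1)))
        (lieDegOne F V k ^ m) h2
      rw [← mul_assoc, ← pow_add] at h3
      exact mul_le_mul_left (pow_mono_lieDegOne k (by omega)) _ h3
  have hi : ((i + 1 : ℕ) : F) ≠ 0 := Nat.cast_ne_zero.2 i.succ_ne_zero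
  have key : ((i + 1 : ℕ) : F) • (y * x ^ i * b) =
      (∑ m ∈ Finset.range (i + 1), x ^ m * y * x ^ (i + 1 - 1 - m)) * b -
        (∑ m ∈ Finset.range (i + 1), (x ^ m * y * x ^ (i + 1 - 1 - m) - y * x ^ i)) * b := by
    rw [← sub_mul, Finset.sum_sub_distrib, sub_sub_cancel, Finset.sum_const, Finset.card_range,
      Nat.cast_smul_eq_nsmul, smul_mul_assoc]
  refine (Submodule.smul_mem_iff _ hi).1 ?_
  rw [key]
  refine sub_mem (le_powFiltration k le_rfl (Submodule.mul_mem_mul h hb)) ?_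
  have h4 := Submodule.mul_mem_mul h' (show b ∈ (lieTail F V (k + 1)).toSubmodule from hb)
  rw [mul_assoc, (Subalgebra.isIdempotentElem_toSubmodule _).eq] at h4
  exact powFiltration_mono k i.le_succ (ih h4)

theorem pow_mul_le_powFiltration [CharZero F] {k : ℕ} (hk : k ≠ 0) (n : ℕ) :
    lieDegOne F V k ^ n * (lieTail F V (k + 1)).toSubmodule ≤ powFiltration F V k n := by
  induction n using Nat.strong_induction_on with
  | _ n ih =>
  rcases n with _ | n
  · rw [pow_zero, ← Submodule.powerSpan_zero (lieDeg F V k)]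
    exact le_powFiltration k le_rfl
  · rw [pow_succ', mul_assoc]
    refine (mul_le_mul_right (ih n n.lt_succ_self) _).trans ?_
    conv_lhs => rw [lieDegOne, Submodule.sup_mul, one_mul]
    refine sup_le ?_ (powFiltration_mono k n.le_succ)
    conv_lhs => rw [powFiltration]
    simp only [Submodule.mul_iSup]
    refine iSup₂_le fun i hi => ?_
    have hi := Finset.mem_range.1 hi
    rw [Submodule.mul_le]
    intro y hy z hz
    induction hz using Submodule.mul_induction_on' with
    | mem_mul_mem z hz b hb =>
      rw [← mul_assoc]
      refine powFiltration_mono k (show i + 1 ≤ n + 1 by omega) ?_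
      induction hz using Submodule.span_induction with
      | mem z hz =>
        obtain ⟨x, hx, rfl⟩ := hz
        exact mul_pow_mem_powFiltration hk (ih i (by omega)) hx hy hb
      | zero => rw [mul_zero, zero_mul]; exact zero_mem _
      | add z w _ _ hz hw => rw [mul_add, add_mul]; exact add_mem hz hw
      | smul c z _ hz =>
        rw [mul_smul_comm, smul_mul_assoc]
        exact Submodule.smul_mem _ c hz
    | add a _ b _ ha hb => rw [mul_add]; exact add_mem ha hb

/-- This is the surjective half of the factorization: the right side contains `1` and is stable
under left multiplication by the generators of the left side. -/
theorem lieTail_le_iSup [CharZero F] {k : ℕ} (hk : k ≠ 0) : (lieTail F V k).toSubmodule ≤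
    ⨆ n, (lieDeg F V k).powerSpan n * (lieTail F V (k + 1)).toSubmodule := by
  set S := ⨆ n, (lieDeg F V k).powerSpan n * (lieTail F V (k + 1)).toSubmodule
  have hS : ∀ n, lieDegOne F V k ^ n * (lieTail F V (k + 1)).toSubmodule ≤ S := fun n =>
    (pow_mul_le_powFiltration hk n).trans (iSup₂_le fun i _ =>
      le_iSup (fun n => (lieDeg F V k).powerSpan n * (lieTail F V (k + 1)).toSubmodule) i)
  have hle : ∀ n, (lieDeg F V k).powerSpan n * (lieTail F V (k + 1)).toSubmodule ≤
      lieDegOne F V k ^ n * (lieTail F V (k + 1)).toSubmodule := fun n =>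
    mul_le_mul_left (((lieDeg F V k).powerSpan_le_pow n).trans (pow_le_pow_left' le_sup_left n)) _
  have hmul : ∀ a ∈ lieTail F V k, ∀ s ∈ S, a * s ∈ S := by
    intro a ha
    induction ha using Algebra.adjoin_induction with
    | mem a ha =>
      obtain ⟨n, hn, ha⟩ := ha
      intro s hs
      induction hs using Submodule.iSup_induction' with
      | mem i s hs =>
        have hs := hle i hs
        rcases hn.eq_or_lt with rfl | hn
        · refine hS (i + 1) ?_
          rw [pow_succ', mul_assoc]
          exact Submodule.mul_mem_mul (Submodule.mem_sup_left ha) hs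
        · exact hS i (tail_mul_pow_mul_le k i
            (Submodule.mul_mem_mul (mem_lieTail (F := F) (V := V) hn ha) hs))
      | zero => rw [mul_zero]; exact zero_mem _
      | add s t _ _ hs ht => rw [mul_add]; exact add_mem hs ht
    | algebraMap r => intro s hs; rw [← Algebra.smul_def]; exact S.smul_mem r hs
    | add a b _ _ ha hb => intro s hs; rw [add_mul]; exact add_mem (ha s hs) (hb s hs)
    | mul a b _ _ ha hb => intro s hs; rw [mul_assoc]; exact ha _ (hb s hs)
  intro a ha
  rw [← mul_one a]
  refine hmul a ha 1 (hS 0 ?_)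
  rw [pow_zero, one_mul]
  exact one_mem (lieTail F V (k + 1))

/-! ### Homogeneous components -/

variable (F V) in
/-- The homogeneous component of degree `n` of the subalgebra generated by the Lie powers of degree
at least `k`. -/
noncomputable def tailDeg (k n : ℕ) : Submodule F (TensorAlgebra F V) :=
  deg F V n ⊓ (lieTail F V k).toSubmodule

theorem lieTail_le_iSup_tailDeg (k : ℕ) :
    (lieTail F V k).toSubmodule ≤ ⨆ n, tailDeg F V k n := by
  intro a ha
  rw [Subalgebra.mem_toSubmodule] at ha
  induction ha using Algebra.adjoin_induction with
  | mem a ha =>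
    obtain ⟨n, hn, ha⟩ := ha
    exact Submodule.mem_iSup_of_mem n ⟨ha.1, mem_lieTail hn ha⟩
  | algebraMap r =>
    refine Submodule.mem_iSup_of_mem 0 ⟨?_, algebraMap_mem (lieTail F V k) r⟩
    rw [deg, pow_zero]
    exact Submodule.algebraMap_mem r
  | add a b _ _ ha hb => exact add_mem ha hb
  | mul a b _ _ ha hb =>
    have h := Submodule.mul_mem_mul ha hb
    simp only [Submodule.mul_iSup, Submodule.iSup_mul] at h
    refine SetLike.le_def.1 (iSup₂_le fun m n => ?_) h
    refine le_trans ?_ (le_iSup _ (n + m))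
    rw [Submodule.mul_le]
    exact fun x hx y hy => ⟨mul_mem_deg hx.1 hy.1, (lieTail F V k).mul_mem hx.2 hy.2⟩

theorem powerSpan_le_tailDeg (k i : ℕ) :
    (lieDeg F V k).powerSpan i ≤ tailDeg F V k (k * i) := by
  rw [Submodule.powerSpan, Submodule.span_le]
  rintro _ ⟨x, hx, rfl⟩
  refine ⟨?_, (lieTail F V k).pow_mem (mem_lieTail le_rfl hx) i⟩
  rw [deg, pow_mul]
  exact Submodule.pow_mem_pow _ hx.1 i

theorem tailDeg_zero (k : ℕ) : tailDeg F V k 0 = 1 := by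
  rw [tailDeg, deg, pow_zero, inf_eq_left, Submodule.one_le]
  exact one_mem (lieTail F V k)

theorem tailDeg_one (n : ℕ) : tailDeg F V 1 n = deg F V n := by
  rw [tailDeg, lieTail_one, Algebra.top_toSubmodule, inf_top_eq]

/-- The sum of the components of degree `0` and of degrees at least `k` is closed under
multiplication and contains the generators. -/
theorem tailDeg_eq_bot {k n : ℕ} (hn : n ≠ 0) (h : n < k) : tailDeg F V k n = ⊥ := by
  let H : ℕ → Submodule F (TensorAlgebra F V) := fun m =>
    if m = 0 ∨ k ≤ m then deg F V m else ⊥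
  have hle : (lieTail F V k).toSubmodule ≤ ⨆ m, H m := by
    intro a ha
    rw [Subalgebra.mem_toSubmodule] at ha
    induction ha using Algebra.adjoin_induction with
    | mem a ha =>
      obtain ⟨m, hm, ha⟩ := ha
      refine Submodule.mem_iSup_of_mem m ?_
      simp only [H, if_pos (Or.inr hm)]
      exact ha.1
    | algebraMap r =>
      refine Submodule.mem_iSup_of_mem 0 ?_
      simp only [H, true_or, if_true, deg, pow_zero]
      exact Submodule.algebraMap_mem r
    | add a b _ _ ha hb => exact add_mem ha hb
    | mul a b _ _ ha hb =>
      have hab := Submodule.mul_mem_mul ha hb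
      simp only [Submodule.mul_iSup, Submodule.iSup_mul] at hab
      refine SetLike.le_def.1 (iSup₂_le fun m l => ?_) hab
      refine le_trans ?_ (le_iSup H (l + m))
      by_cases hm : m = 0 ∨ k ≤ m
      · by_cases hl : l = 0 ∨ k ≤ l
        · have hlm : l + m = 0 ∨ k ≤ l + m := by omega
          simp only [H, if_pos hm, if_pos hl, if_pos hlm]
          rw [Submodule.mul_le]
          exact fun x hx y hy => mul_mem_deg hx hy
        · simp only [H, if_neg hl, Submodule.bot_mul, bot_le]
      · simp only [H, if_neg hm, Submodule.mul_bot, bot_le]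
  have hker : ⨆ m, H m ≤ LinearMap.ker (degProj F V n) := by
    refine iSup_le fun m => ?_
    by_cases hm : m = 0 ∨ k ≤ m
    · simp only [H, if_pos hm]
      exact fun x hx => degProj_of_mem_ne hx (by omega)
    · simp only [H, if_neg hm, bot_le]
  rw [eq_bot_iff]
  intro x hx
  rw [Submodule.mem_bot, ← degProj_of_mem hx.1]
  exact hker (hle hx.2)

/-- The homogeneous components of `S(L^k(V)) ⊗ A`, embedded into `T(V)`, where `A` is the subalgebra
generated by the Lie powers of degree greater than `k`. -/
theorem tailDeg_eq_iSup [CharZero F] {k : ℕ} (hk : k ≠ 0) (n : ℕ) :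
    tailDeg F V k n = ⨆ a ∈ Finset.range (n + 1),
      -- The index `a` is the degree of the first factor, so that the terms match the coefficients
      -- of a product with `expand k` in `tailSeries_eq_mul`.
      if k ∣ a then (lieDeg F V k).powerSpan (a / k) * tailDeg F V (k + 1) (n - a) else ⊥ := by
  apply le_antisymm
  · intro x hx
    rw [← degProj_of_mem hx.1]
    have h1 : (lieTail F V k).toSubmodule ≤
        ⨆ i, ⨆ m, (lieDeg F V k).powerSpan i * tailDeg F V (k + 1) m := by
      refine (lieTail_le_iSup hk).trans (iSup_mono fun i => ?_)
      rw [← Submodule.mul_iSup]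
      exact mul_le_mul_right (lieTail_le_iSup_tailDeg (k + 1)) _
    have h2 := Submodule.mem_map_of_mem (f := degProj F V n) (h1 hx.2)
    simp only [Submodule.map_iSup] at h2
    refine SetLike.le_def.1 (iSup₂_le fun i m => ?_) h2
    rintro _ ⟨y, hy, rfl⟩
    have hy' : y ∈ deg F V (k * i + m) := by
      rw [deg, pow_add]
      exact mul_le_mul' ((powerSpan_le_tailDeg k i).trans inf_le_left) inf_le_left hy
    by_cases hn : k * i + m = n
    · subst hn
      rw [degProj_of_mem hy']
      refine SetLike.le_def.1 (le_iSup₂_of_le (k * i)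
        (Finset.mem_range.2 (Nat.lt_succ_of_le (Nat.le_add_right _ _))) ?_) hy
      rw [if_pos (dvd_mul_right k i), Nat.mul_div_cancel_left i (Nat.pos_of_ne_zero hk),
        Nat.add_sub_cancel_left]
    · rw [degProj_of_mem_ne hy' hn]
      exact zero_mem _
  · refine iSup₂_le fun a ha => ?_
    have ha := Finset.mem_range.1 ha
    split_ifs with h
    · obtain ⟨i, rfl⟩ := h
      rw [Nat.mul_div_cancel_left i (Nat.pos_of_ne_zero hk), Submodule.mul_le]
      intro x hx y hy
      have hx := powerSpan_le_tailDeg k i hx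
      refine ⟨?_, (lieTail F V k).mul_mem hx.2 (lieTail_anti k.le_succ hy.2)⟩
      have := mul_mem_deg hx.1 hy.1
      rwa [show k * i + (n - k * i) = n by omega] at this
    · exact bot_le

/-! ### Left multiplication by elements of `V` -/

/-- `T(V)` is made to act on `F × (V ⊗ T(V))` by letting `v` send `z` to `(0, v ⊗ m' z)`. Since `m'`
intertwines this with left multiplication, acting on `(1, 0)` and taking the second component is a
left inverse. -/
theorem mul'_ι_injective : Function.Injective (LinearMap.mul' F (TensorAlgebra F V) ∘ₗ
    TensorProduct.map (ι F : V →ₗ[F] TensorAlgebra F V) LinearMap.id) := by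
  set m := LinearMap.mul' F (TensorAlgebra F V) ∘ₗ
    TensorProduct.map (ι F : V →ₗ[F] TensorAlgebra F V) LinearMap.id
  let m' : F × (V ⊗[F] TensorAlgebra F V) →ₗ[F] TensorAlgebra F V :=
    (Algebra.linearMap F _).coprod m
  let Θ : TensorAlgebra F V →ₐ[F] Module.End F (F × (V ⊗[F] TensorAlgebra F V)) :=
    lift F (((LinearMap.llcomp F _ _ _).flip m') ∘ₗ
      (LinearMap.llcomp F _ _ _ (LinearMap.inr F F (V ⊗[F] TensorAlgebra F V))) ∘ₗ
        TensorProduct.mk F V (TensorAlgebra F V))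
  have hΘ : ∀ v z, Θ (ι F v) z = (0, v ⊗ₜ m' z) := fun v z => by
    simp [Θ]
  have hm : ∀ a z, m' (Θ a z) = a * m' z := by
    intro a
    induction a using TensorAlgebra.induction with
    | algebraMap r => intro z; rw [AlgHom.commutes, ← Algebra.smul_def]; simp
    | ι v => intro z; rw [hΘ]; simp [m', m]
    | mul a b ha hb => intro z; rw [map_mul, Module.End.mul_apply, ha, hb, mul_assoc]
    | add a b ha hb => intro z; rw [map_add, LinearMap.add_apply, map_add, ha, hb, add_mul]
  let r : TensorAlgebra F V →ₗ[F] V ⊗[F] TensorAlgebra F V :=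
    LinearMap.snd F _ _ ∘ₗ LinearMap.applyₗ (1, 0) ∘ₗ Θ.toLinearMap
  have hr : r ∘ₗ m = LinearMap.id := by
    apply TensorProduct.ext'
    intro v a
    have : m' (Θ a (1, 0)) = a := by rw [hm]; simp [m']
    change (Θ (ι F v * a) (1, 0)).2 = _
    rw [map_mul, Module.End.mul_apply, hΘ, this]
    rfl
  exact Function.LeftInverse.injective (g := r) fun x => DFunLike.congr_fun hr x

end Lie

end TensorAlgebra

/-! ### The factorization of the tensor algebra in the Green ring. -/

namespace GreenRingLie

section Lie

attribute [local instance] LieRing.ofAssociativeRing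

variable {F : Type u} [Field F] {G : Type v} [Group G]

open TensorAlgebra (deg lieDeg tailDeg lieTail)

theorem tensorAction_apply (V : FinMod F G) (g : G) (x : TensorAlgebra F V.carrier) :
    V.tensorAction g x = TensorAlgebra.lift F (TensorAlgebra.ι F ∘ₗ V.ρ g) x := rfl

theorem tensorAction_mul (V : FinMod F G) (g : G) (x y : TensorAlgebra F V.carrier) :
    V.tensorAction g (x * y) = V.tensorAction g x * V.tensorAction g y := by
  simp only [tensorAction_apply, map_mul]

theorem tensorAction_one (V : FinMod F G) (g : G) : V.tensorAction g 1 = 1 := by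
  simp only [tensorAction_apply, map_one]

theorem tensorAction_ι (V : FinMod F G) (g : G) (x : V.carrier) :
    V.tensorAction g (TensorAlgebra.ι F x) = TensorAlgebra.ι F (V.ρ g x) := by
  simp [tensorAction_apply]

theorem tensorAction_pow (V : FinMod F G) (g : G) (x : TensorAlgebra F V.carrier) (n : ℕ) :
    V.tensorAction g (x ^ n) = V.tensorAction g x ^ n := by
  simp only [tensorAction_apply, map_pow]

theorem deg_le_comap (V : FinMod F G) (n : ℕ) (g : G) :
    deg F V.carrier n ≤ (deg F V.carrier n).comap (V.tensorAction g) := by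
  rw [← Submodule.map_le_iff_le_comap]
  change Submodule.map (TensorAlgebra.lift F (TensorAlgebra.ι F ∘ₗ V.ρ g)).toLinearMap (_ ^ n) ≤ _
  rw [Submodule.map_pow]
  refine pow_le_pow_left' ?_ n
  rintro _ ⟨_, ⟨x, rfl⟩, rfl⟩
  exact ⟨V.ρ g x, by simp⟩

theorem finiteDimensional_deg (V : FinMod F G) (n : ℕ) :
    FiniteDimensional F (deg F V.carrier n) :=
  .of_fg (by
    rw [deg, LinearMap.range_eq_map]
    exact (Module.Finite.fg_top.map (TensorAlgebra.ι F)).pow n)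

theorem lieDeg_le_comap (V : FinMod F G) (n : ℕ) (g : G) :
    lieDeg F V.carrier n ≤ (lieDeg F V.carrier n).comap (V.tensorAction g) :=
  V.lieComponent_le_comap n g

theorem tailDeg_le_comap (V : FinMod F G) (k n : ℕ) (g : G) :
    tailDeg F V.carrier k n ≤ (tailDeg F V.carrier k n).comap (V.tensorAction g) := by
  rintro x ⟨hx, hx'⟩
  refine ⟨deg_le_comap V n g hx, ?_⟩
  have h : lieTail F V.carrier k ≤ (lieTail F V.carrier k).comap
      (TensorAlgebra.lift F (TensorAlgebra.ι F ∘ₗ V.ρ g)) := by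
    refine Algebra.adjoin_le ?_
    rintro y ⟨m, hm, hy⟩
    exact TensorAlgebra.mem_lieTail hm (lieDeg_le_comap V m g hy)
  exact h hx'

theorem finiteDimensional_tailDeg (V : FinMod F G) (k n : ℕ) :
    FiniteDimensional F (tailDeg F V.carrier k n) :=
  have := finiteDimensional_deg V n
  Submodule.finiteDimensional_of_le inf_le_left

theorem powerSpan_le_comap (V : FinMod F G) (k i : ℕ) (g : G) :
    (lieDeg F V.carrier k).powerSpan i ≤
      ((lieDeg F V.carrier k).powerSpan i).comap (V.tensorAction g) := by
  conv_lhs => rw [Submodule.powerSpan]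
  rw [Submodule.span_le]
  rintro _ ⟨x, hx, rfl⟩
  rw [SetLike.mem_coe, Submodule.mem_comap, tensorAction_pow]
  exact Submodule.pow_mem_powerSpan (Submodule.mem_comap.1 (lieDeg_le_comap V k g hx)) i

/-- The classes of the homogeneous components of the subalgebra of `T(V)` generated by the Lie
powers of degree at least `k`. -/
noncomputable def FinMod.tailSeries (V : FinMod F G) (k : ℕ) : Ser F G :=
  PowerSeries.mk fun n => subCls V.tensorAction (tailDeg F V.carrier k n)

/-- Symmetrization `x^i ↦ x^i` followed by multiplication embeds `S^i(L^k(V)) ⊗ A` equivariantly in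
`T(V)`, where `A` is the component of degree `n` of the tail. -/
theorem subCls_powerSpan_mul_tailDeg [CharZero F] (V : FinMod F G) {k : ℕ} (hk : k ≠ 0)
    (i n : ℕ) : subCls V.tensorAction
      ((lieDeg F V.carrier k).powerSpan i * tailDeg F V.carrier (k + 1) n) =
      ((V.liePow k).symPow i).cls * subCls V.tensorAction (tailDeg F V.carrier (k + 1) n) := by
  have hfin : FiniteDimensional F (lieDeg F V.carrier k) := (V.liePow k).finite
  let b := Module.finBasis F (lieDeg F V.carrier k)
  let j := (lieDeg F V.carrier k).subtype
  choose D hD hD0 using TensorAlgebra.exists_derivative (F := F) (V := V.carrier) hk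
  let τ : Representation F G (SymmetricAlgebra F (lieDeg F V.carrier k)) := (V.liePow k).symAction
  let P : Submodule F (SymmetricAlgebra F (lieDeg F V.carrier k)) :=
    LinearMap.range (SymmetricAlgebra.ι F _) ^ i
  have hP : ((V.liePow k).symPow i).cls = subCls τ P := cls_symPow (V.liePow k) i
  have hmap : P.map (SymmetricAlgebra.powMap b j i) = (lieDeg F V.carrier k).powerSpan i := by
    rw [SymmetricAlgebra.map_powMap, Submodule.range_subtype]
  have hρ : ∀ g (x : lieDeg F V.carrier k), τ g (SymmetricAlgebra.ι F _ x) =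
      SymmetricAlgebra.ι F _ ⟨V.tensorAction g x, lieDeg_le_comap V k g x.2⟩ := fun g x =>
    SymmetricAlgebra.map_ι _ _
  have hτpow : ∀ g x, τ g (x ^ i) = τ g x ^ i := fun g x =>
    map_pow (SymmetricAlgebra.map ((V.liePow k).ρ g)) x i
  rw [hP, ← hmap]
  have h := subCls_map_mul_map (ρA := τ) (ρB := V.tensorAction) (tensorAction_mul V) P
    ((V.liePow k).symComponent_le_comap i) ((V.liePow k).symPow i).finite
    (tailDeg F V.carrier (k + 1) n) (tailDeg_le_comap V (k + 1) n)
    (finiteDimensional_tailDeg V (k + 1) n) (SymmetricAlgebra.powMap b j i) LinearMap.id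
    (fun g x hx => ?_) (fun g x _ => rfl) ?_
  · rwa [Submodule.map_id] at h
  -- `powMap` is built from a basis, so its equivariance is not visible from the definition; it is
  -- checked on powers, where the basis drops out.
  · refine SymmetricAlgebra.eq_of_eq_on_powers (n := i)
      (f := SymmetricAlgebra.powMap b j i ∘ₗ τ g)
      (f' := V.tensorAction g ∘ₗ SymmetricAlgebra.powMap b j i) (fun x => ?_) hx
    rw [LinearMap.comp_apply, LinearMap.comp_apply, hτpow, hρ, SymmetricAlgebra.powMap_ι_pow,
      SymmetricAlgebra.powMap_ι_pow, tensorAction_pow]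
    rfl
  · exact SymmetricAlgebra.mul'_powMap_injective b j (tailDeg F V.carrier (k + 1) n) D
      (fun l x m c hc => hD l x m c hc.2) i

/-- One step of the Poincaré–Birkhoff–Witt theorem: the subalgebra generated in degrees at least `k`
is `S(L^k(V))` tensored with the next one. -/
theorem tailSeries_eq_mul [CharZero F] (V : FinMod F G) {k : ℕ} (hk : k ≠ 0) :
    V.tailSeries k =
      PowerSeries.expand k hk ((V.liePow k).symSeries : Ser F G) * V.tailSeries (k + 1) := by
  have hfin : FiniteDimensional F (lieDeg F V.carrier k) := (V.liePow k).finite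
  let b := Module.finBasis F (lieDeg F V.carrier k)
  let j := (lieDeg F V.carrier k).subtype
  choose D hD hD0 using TensorAlgebra.exists_derivative (F := F) (V := V.carrier) hk
  obtain ⟨E, hE⟩ := SymmetricAlgebra.exists_end_powerSpan_mul b j
    (lieTail F V.carrier (k + 1)).toSubmodule D hD hD0
  rw [Submodule.range_subtype] at hE
  ext n
  rw [FinMod.tailSeries, PowerSeries.coeff_mk, TensorAlgebra.tailDeg_eq_iSup hk,
    PowerSeries.coeff_mul, Finset.Nat.sum_antidiagonal_eq_sum_range_succ_mk, subCls_biSup]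
  · refine Finset.sum_congr rfl fun a _ => ?_
    rw [PowerSeries.coeff_expand]
    split_ifs with ha
    · rw [subCls_powerSpan_mul_tailDeg V hk, coeff_symSeries, FinMod.tailSeries,
        PowerSeries.coeff_mk]
    · rw [subCls_bot, zero_mul]
  · intro a _ g
    split_ifs with ha
    · rw [Submodule.mul_le]
      intro x hx y hy
      rw [Submodule.mem_comap, tensorAction_mul]
      exact Submodule.mul_mem_mul (powerSpan_le_comap V k _ g hx) (tailDeg_le_comap V _ _ g hy)
    · exact bot_le
  · intro a _
    have := finiteDimensional_deg V (k * (a / k))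
    have h1 := (Submodule.fg_iff_finiteDimensional _).2 (Submodule.finiteDimensional_of_le
      ((TensorAlgebra.powerSpan_le_tailDeg (F := F) (V := V.carrier) k (a / k)).trans inf_le_left))
    have h2 := (Submodule.fg_iff_finiteDimensional _).2
      (finiteDimensional_tailDeg V (k + 1) (n - a))
    by_cases ha : k ∣ a
    · rw [if_pos ha]
      exact .of_fg (h1.mul h2)
    · rw [if_neg ha]
      infer_instance
  -- `E` counts the factors from `L^k(V)`, so `k • E` acts by the scalar `a` on the summand of index
  -- `a`; these scalars are distinct in characteristic `0`.
  · refine iSupIndep.supIndep' _ ((((k : F) • E).eigenspaces_iSupIndep.comp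
      (Nat.cast_injective (R := F))).mono fun a => ?_)
    split_ifs with ha
    · intro x hx
      have hx' : x ∈ (lieDeg F V.carrier k).powerSpan (a / k) *
          (lieTail F V.carrier (k + 1)).toSubmodule :=
        SetLike.le_def.1 (mul_le_mul_right inf_le_right _) hx
      rw [Function.comp_apply, Module.End.mem_eigenspace_iff, LinearMap.smul_apply, hE _ x hx',
        smul_smul, ← Nat.cast_mul, Nat.mul_div_cancel' ha]
    · exact bot_le

theorem X_pow_dvd_tailSeries_sub_one (V : FinMod F G) (k : ℕ) :
    (PowerSeries.X : Ser F G) ^ k ∣ V.tailSeries k - 1 := by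
  rw [PowerSeries.X_pow_dvd_iff]
  intro n hn
  rw [map_sub, FinMod.tailSeries, PowerSeries.coeff_mk, PowerSeries.coeff_one]
  split_ifs with h
  · rw [h, TensorAlgebra.tailDeg_zero, subCls_one (tensorAction_one V), sub_self]
  · rw [TensorAlgebra.tailDeg_eq_bot h hn, subCls_bot, sub_zero]

theorem subCls_deg_succ (V : FinMod F G) (n : ℕ) :
    subCls V.tensorAction (deg F V.carrier (n + 1)) =
      V.cls * subCls V.tensorAction (deg F V.carrier n) := by
  have h := subCls_map_mul_map (ρA := V.ρ) (ρB := V.tensorAction) (tensorAction_mul V) ⊤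
    (fun _ => le_top) inferInstance (deg F V.carrier n) (deg_le_comap V n)
    (finiteDimensional_deg V n) (TensorAlgebra.ι F) LinearMap.id
    (fun g x _ => (tensorAction_ι V g x).symm) (fun g x _ => rfl) ?_
  · have hV : subCls V.ρ ⊤ = V.cls := by
      rw [← LinearMap.range_id]
      exact subCls_range V LinearMap.id Function.injective_id fun _ _ => rfl
    rw [Submodule.map_id, Submodule.map_top, hV] at h
    rw [← h, deg, pow_succ']
  · have : LinearMap.mul' F (TensorAlgebra F V.carrier) ∘ₗ TensorProduct.map
        (TensorAlgebra.ι F ∘ₗ (⊤ : Submodule F V.carrier).subtype)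
        (LinearMap.id ∘ₗ (deg F V.carrier n).subtype) =
        (LinearMap.mul' F (TensorAlgebra F V.carrier) ∘ₗ
          TensorProduct.map (TensorAlgebra.ι F) LinearMap.id) ∘ₗ
        TensorProduct.mapIncl ⊤ (deg F V.carrier n) := by
      apply TensorProduct.ext'
      intro x y
      rfl
    rw [this, LinearMap.coe_comp]
    exact TensorAlgebra.mul'_ι_injective.comp
      (TensorProduct.map_injective_of_flat_flat _ _ (Submodule.subtype_injective _)
        (Submodule.subtype_injective _))

/-- The tail of index `1` is all of `T(V)`, and `T^{n+1}(V) ≅ V ⊗ T^n(V)` makes its series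
geometric. -/
theorem tailSeries_one_mul (V : FinMod F G) :
    V.tailSeries 1 * (1 - PowerSeries.monomial 1 V.cls) = 1 := by
  have h : V.tailSeries 1 * PowerSeries.monomial 1 V.cls =
      PowerSeries.C V.cls * (V.tailSeries 1 * PowerSeries.X) := by
    rw [PowerSeries.X_eq, mul_left_comm, ← PowerSeries.monomial_zero_eq_C_apply,
      PowerSeries.monomial_mul_monomial, zero_add, mul_one]
  ext n
  rw [mul_sub, mul_one, map_sub, PowerSeries.coeff_one, h, PowerSeries.coeff_C_mul]
  rcases n with _ | n
  · rw [PowerSeries.coeff_zero_mul_X, mul_zero, sub_zero, if_pos rfl, FinMod.tailSeries,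
      PowerSeries.coeff_mk, TensorAlgebra.tailDeg_zero, subCls_one (tensorAction_one V)]
  · rw [PowerSeries.coeff_succ_mul_X, if_neg n.succ_ne_zero, FinMod.tailSeries,
      PowerSeries.coeff_mk, PowerSeries.coeff_mk, TensorAlgebra.tailDeg_one,
      TensorAlgebra.tailDeg_one, subCls_deg_succ, sub_self]

theorem cls_liePow_one (V : FinMod F G) : (V.liePow 1).cls = V.cls := by
  have h : (V.liePow 1).cls = subCls V.tensorAction (V.lieComponent 1) :=
    (subCls_eq _ _ (V.lieComponent_le_comap 1) (V.liePow 1).finite).symm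
  have h' : V.lieComponent 1 = LinearMap.range (TensorAlgebra.ι F : V.carrier →ₗ[F] _) := by
    rw [FinMod.lieComponent, pow_one, inf_eq_left]
    rintro _ ⟨x, rfl⟩
    exact LieSubalgebra.subset_lieSpan ⟨x, rfl⟩
  rw [h, h']
  exact subCls_range V _ TensorAlgebra.ι_leftInverse.injective
    fun g x => (tensorAction_ι V g x).symm

end Lie

end GreenRingLie

namespace GreenRingLie

variable {F : Type u} [Field F] {G : Type v} [Group G]

/-! ### The additive function `S⁺` -/

theorem coeff_zero_coe (f : TSer F G) : PowerSeries.coeff 0 (f : Ser F G) = 0 := by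
  rw [PowerSeries.coeff_zero_eq_constantCoeff_apply]
  exact f.2

theorem coeff_SPlus (f : TSer F G) (n : ℕ) : PowerSeries.coeff n (SPlus f : Ser F G) =
    ∑ i ∈ Finset.range n, PowerSeries.coeff n (PowerSeries.expand (i + 1) i.succ_ne_zero
        (psi F G (PowerSeries.coeff (i + 1) (f : Ser F G)) : Ser F G)) := by
  rw [SPlus, PowerSeries.coeff_mk]

theorem SPlus_add (f g : TSer F G) : SPlus (f + g) = SPlus f + SPlus g := by
  refine Subtype.ext (PowerSeries.ext fun n => ?_)
  rw [Submodule.coe_add, map_add, coeff_SPlus, coeff_SPlus, coeff_SPlus, ← Finset.sum_add_distrib]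
  refine Finset.sum_congr rfl fun i _ => ?_
  rw [Submodule.coe_add, map_add, map_add, Submodule.coe_add, map_add, map_add]

/-- The top coefficient of `f` enters with factor `1`, and the rest involves lower coefficients
only: `S⁺` is unitriangular. -/
theorem coeff_SPlus_succ [CharZero F] (f : TSer F G) (n : ℕ) :
    PowerSeries.coeff (n + 1) (SPlus f : Ser F G) =
      ∑ i ∈ Finset.range n, PowerSeries.coeff (n + 1) (PowerSeries.expand (i + 1) i.succ_ne_zero
        (psi F G (PowerSeries.coeff (i + 1) (f : Ser F G)) : Ser F G)) +
      PowerSeries.coeff (n + 1) (f : Ser F G) := by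
  rw [coeff_SPlus, Finset.sum_range_succ, PowerSeries.coeff_expand, if_pos dvd_rfl,
    Nat.div_self n.succ_pos, coeff_one_psi]

theorem SPlus_eq_expand (f : TSer F G) (r : ℕ) (hr : r ≠ 0) (a : Gam F G)
    (hf : (f : Ser F G) = PowerSeries.monomial r a) :
    (SPlus f : Ser F G) = PowerSeries.expand r hr (psi F G a : Ser F G) := by
  obtain ⟨r, rfl⟩ := Nat.exists_eq_succ_of_ne_zero hr
  ext n
  rw [coeff_SPlus]
  have h0 : ∀ i, i ≠ r → PowerSeries.coeff n (PowerSeries.expand (i + 1) i.succ_ne_zero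
      (psi F G (PowerSeries.coeff (i + 1) (f : Ser F G)) : Ser F G)) = 0 := fun i hi => by
    rw [hf, PowerSeries.coeff_monomial, if_neg (by omega), map_zero, Submodule.coe_zero, map_zero,
      map_zero]
  by_cases hn : r < n
  · rw [Finset.sum_eq_single_of_mem r (Finset.mem_range.2 hn) fun i _ hi => h0 i hi, hf,
      PowerSeries.coeff_monomial_same]
  -- For `n ≤ r` the sum misses the index `r`, but the right side vanishes too: `r + 1` divides `n`
  -- only for `n = 0`, where the constant term is `0`.
  · rw [Finset.sum_eq_zero fun i hi => h0 i (by have := Finset.mem_range.1 hi; omega),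
      PowerSeries.coeff_expand]
    split_ifs with h
    · rw [Nat.eq_zero_of_dvd_of_lt h (by omega), Nat.zero_div]
      exact (coeff_zero_coe _).symm
    · rfl

theorem X_pow_dvd_SPlus_iff [CharZero F] (f : TSer F G) (n : ℕ) :
    (PowerSeries.X : Ser F G) ^ n ∣ (SPlus f : Ser F G) ↔
      (PowerSeries.X : Ser F G) ^ n ∣ (f : Ser F G) := by
  rw [PowerSeries.X_pow_dvd_iff, PowerSeries.X_pow_dvd_iff]
  have key : ∀ m, (∀ i ≤ m, PowerSeries.coeff i (f : Ser F G) = 0) →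
      PowerSeries.coeff (m + 1) (SPlus f : Ser F G) = PowerSeries.coeff (m + 1) (f : Ser F G) := by
    intro m hm
    rw [coeff_SPlus_succ, Finset.sum_eq_zero, zero_add]
    intro i hi
    rw [hm (i + 1) (Finset.mem_range.1 hi), map_zero, Submodule.coe_zero, map_zero, map_zero]
  constructor
  · intro h m
    induction m using Nat.strong_induction_on with
    | _ m ih =>
      intro hm
      rcases m with _ | m
      · exact coeff_zero_coe f
      · rw [← key m fun i hi => ih i (by omega) (by omega)]
        exact h _ hm
  · intro h m hm
    rcases m with _ | m
    · exact coeff_zero_coe _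
    · rw [key m fun i hi => h i (by omega)]
      exact h _ hm

/-- The coefficients of the preimage of a power series under `S⁺`. -/
noncomputable def sPlusPreimageCoeff (g : Ser F G) : ℕ → Gam F G
  | 0 => 0
  | n + 1 => PowerSeries.coeff (n + 1) g -
      ∑ i : Fin n, PowerSeries.coeff (n + 1) (PowerSeries.expand (i + 1) (Nat.succ_ne_zero i)
        (psi F G (sPlusPreimageCoeff g (i + 1)) : Ser F G))
  termination_by n => n
  decreasing_by omega

theorem SPlus_surjective [CharZero F] : Function.Surjective (SPlus : TSer F G → TSer F G) := by
  intro g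
  refine ⟨⟨PowerSeries.mk (sPlusPreimageCoeff (g : Ser F G)), ?_⟩, ?_⟩
  · rw [RingHom.mem_ker, ← PowerSeries.coeff_zero_eq_constantCoeff_apply, PowerSeries.coeff_mk,
      sPlusPreimageCoeff]
  · refine Subtype.ext (PowerSeries.ext fun n => ?_)
    rcases n with _ | n
    · exact (coeff_zero_coe _).trans (coeff_zero_coe g).symm
    · rw [coeff_SPlus_succ]
      simp only [PowerSeries.coeff_mk]
      conv_lhs => rw [sPlusPreimageCoeff.eq_2]
      rw [Finset.sum_range, add_sub_cancel]

theorem eq_of_forall_X_pow_dvd_sub {f g : Ser F G}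
    (h : ∀ n, (PowerSeries.X : Ser F G) ^ n ∣ f - g) : f = g := by
  ext n
  have := PowerSeries.X_pow_dvd_iff.1 (h (n + 1)) n n.lt_succ_self
  rwa [map_sub, sub_eq_zero] at this

/-! ### The function `S*` -/

theorem coe_SStar (f : TSer F G) :
    (SStar f : Ser F G) = (PowerSeries.exp (Gam F G)).subst (SPlus f : Ser F G) := rfl

theorem logOf_SStar (f : TSer F G) :
    PowerSeries.logOf (SStar f : Ser F G) = (SPlus f : Ser F G) :=
  PowerSeries.logOf_exp_subst (SPlus f).2

theorem SStar_add (f g : TSer F G) : (SStar (f + g) : Ser F G) = SStar f * SStar g := by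
  rw [coe_SStar, SPlus_add, Submodule.coe_add]
  exact PowerSeries.exp_subst_add (SPlus f).2 (SPlus g).2

theorem SStar_zero : (SStar (0 : TSer F G) : Ser F G) = 1 := by
  have h := SStar_add (0 : TSer F G) 0
  rw [add_zero] at h
  exact ((PowerSeries.isUnit_of_constantCoeff_eq_one (SStar (0 : TSer F G)).2).mul_left_cancel
    (h.symm.trans (mul_one _).symm))

theorem SStar_neg_mul (f : TSer F G) : (SStar (-f) : Ser F G) * SStar f = 1 := by
  rw [← SStar_add, neg_add_cancel, SStar_zero]

theorem X_pow_dvd_SStar_sub_one_iff [CharZero F] (f : TSer F G) (n : ℕ) :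
    (PowerSeries.X : Ser F G) ^ n ∣ (SStar f : Ser F G) - 1 ↔
      (PowerSeries.X : Ser F G) ^ n ∣ (f : Ser F G) := by
  rw [← X_pow_dvd_SPlus_iff]
  constructor
  · intro h
    rw [← logOf_SStar]
    exact PowerSeries.X_pow_dvd_logOf (SStar f).2 h
  · exact PowerSeries.X_pow_dvd_exp_subst_sub_one (SPlus f).2

theorem SStar_bijective [CharZero F] : Function.Bijective (SStar : TSer F G → OneTSer F G) := by
  constructor
  · intro f g h
    rw [← sub_eq_zero]
    refine Subtype.ext (eq_of_forall_X_pow_dvd_sub fun n => ?_)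
    have h1 : (SStar (f - g) : Ser F G) = 1 := by
      rw [sub_eq_neg_add, SStar_add, h, SStar_neg_mul]
    rw [Submodule.coe_zero, sub_zero, ← X_pow_dvd_SStar_sub_one_iff, h1, sub_self]
    exact dvd_zero _
  · intro g
    obtain ⟨f, hf⟩ := SPlus_surjective
      (⟨PowerSeries.logOf (g : Ser F G), PowerSeries.constantCoeff_logOf g.2⟩ : TSer F G)
    refine ⟨f, Subtype.ext ?_⟩
    rw [coe_SStar, hf]
    exact PowerSeries.exp_subst_logOf g.2

theorem SStar_single [CharZero F] (V : FinMod F G) (r : ℕ) (hr : r ≠ 0) :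
    (SStar (V.single r hr) : Ser F G) = PowerSeries.expand r hr (V.symSeries : Ser F G) := by
  have h1 : PowerSeries.constantCoeff (PowerSeries.expand r hr (V.symSeries : Ser F G)) = 1 := by
    rw [PowerSeries.constantCoeff_expand, V.symSeries.2]
  rw [coe_SStar, SPlus_eq_expand (V.single r hr) r hr V.cls rfl, psi_cls,
    ← PowerSeries.logOf_expand V.symSeries.2, PowerSeries.exp_subst_logOf h1]

/-! ### The Poincaré–Birkhoff–Witt theorem in the Green ring -/

/-- The series `L^1(V) t^r + ⋯ + L^N(V) t^{Nr}`. -/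
noncomputable def FinMod.lieSeriesTrunc (V : FinMod F G) (r : ℕ) (hr : r ≠ 0) (N : ℕ) : TSer F G :=
  ∑ i ∈ Finset.range N, (V.liePow (i + 1)).single (r * (i + 1)) (mul_ne_zero hr i.succ_ne_zero)

theorem X_pow_dvd_lieSeries_sub (V : FinMod F G) (r : ℕ) (hr : r ≠ 0) (N : ℕ) :
    (PowerSeries.X : Ser F G) ^ (N + 1) ∣
      ((V.lieSeries r hr - V.lieSeriesTrunc r hr N : TSer F G) : Ser F G) := by
  rw [PowerSeries.X_pow_dvd_iff]
  intro m hm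
  have hc : ((V.lieSeriesTrunc r hr N : TSer F G) : Ser F G) = ∑ i ∈ Finset.range N,
      PowerSeries.monomial (r * (i + 1)) (V.liePow (i + 1)).cls := by
    rw [FinMod.lieSeriesTrunc, AddSubmonoidClass.coe_finsetSum]
    rfl
  rw [Submodule.coe_sub, map_sub, hc, map_sum, FinMod.lieSeries, PowerSeries.coeff_expand,
    sub_eq_zero]
  simp only [PowerSeries.coeff_mk, PowerSeries.coeff_monomial]
  split_ifs with h h0
  · rw [Finset.sum_eq_zero]
    intro i _
    rw [if_neg]
    obtain ⟨c, rfl⟩ := h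
    rw [Nat.mul_div_cancel_left c (Nat.pos_of_ne_zero hr)] at h0
    rw [h0, mul_zero]
    exact (mul_ne_zero hr i.succ_ne_zero).symm
  · obtain ⟨c, rfl⟩ := h
    rw [Nat.mul_div_cancel_left c (Nat.pos_of_ne_zero hr)] at h0 ⊢
    obtain ⟨c, rfl⟩ := Nat.exists_eq_add_one_of_ne_zero h0
    have hcN : c < N := by
      have := Nat.le_mul_of_pos_left (c + 1) (Nat.pos_of_ne_zero hr)
      omega
    rw [Finset.sum_eq_single_of_mem c (Finset.mem_range.2 hcN), if_pos rfl]
    intro i _ hi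
    rw [if_neg]
    intro h
    have := Nat.eq_of_mul_eq_mul_left (Nat.pos_of_ne_zero hr) h
    omega
  · rw [Finset.sum_eq_zero]
    intro i _
    rw [if_neg]
    rintro rfl
    exact h (dvd_mul_right _ _)

/-- The factorizations `tailSeries_eq_mul` telescope. Finite truncations with an explicit remainder
take the place of an infinite product. -/
theorem SStar_lieSeriesTrunc_mul [CharZero F] (V : FinMod F G) (r : ℕ) (hr : r ≠ 0) (N : ℕ) :
    (SStar (V.lieSeriesTrunc r hr N) : Ser F G) *
      PowerSeries.expand r hr (V.tailSeries (N + 1)) = PowerSeries.expand r hr (V.tailSeries 1) := by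
  induction N with
  | zero =>
    rw [FinMod.lieSeriesTrunc, Finset.sum_range_zero, SStar_zero, one_mul]
  | succ N ih =>
    rw [FinMod.lieSeriesTrunc, Finset.sum_range_succ, SStar_add, SStar_single, ← ih,
      tailSeries_eq_mul V N.succ_ne_zero, map_mul, mul_assoc]
    rw [← PowerSeries.expand_mul r hr (N + 1) N.succ_ne_zero]
    rfl

theorem expand_X_pow_dvd {f : Ser F G} {n : ℕ} (h : (PowerSeries.X : Ser F G) ^ n ∣ f) (r : ℕ)
    (hr : r ≠ 0) : (PowerSeries.X : Ser F G) ^ n ∣ PowerSeries.expand r hr f := by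
  obtain ⟨q, rfl⟩ := h
  rw [map_mul, map_pow, PowerSeries.expand_X, ← pow_mul]
  exact Dvd.dvd.mul_right
    (pow_dvd_pow _ (Nat.le_mul_of_pos_left n (Nat.pos_of_ne_zero hr))) _

/-- Modulo a given power of `t`, both the remainder of the telescoping product and the factor from
truncating the Lie series are `1`. -/
theorem SStar_lieSeries_mul [CharZero F] (V : FinMod F G) (r : ℕ) (hr : r ≠ 0) :
    (SStar (V.lieSeries r hr) : Ser F G) * (1 - PowerSeries.monomial r V.cls) = 1 := by
  refine eq_of_forall_X_pow_dvd_sub fun n => ?_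
  refine (pow_dvd_pow _ n.le_succ).trans ?_
  set R : TSer F G := V.lieSeries r hr - V.lieSeriesTrunc r hr n
  set E := PowerSeries.expand r hr (V.tailSeries (n + 1))
  have hR : (PowerSeries.X : Ser F G) ^ (n + 1) ∣ (SStar R : Ser F G) - 1 :=
    (X_pow_dvd_SStar_sub_one_iff R _).2 (X_pow_dvd_lieSeries_sub V r hr n)
  have hE : (PowerSeries.X : Ser F G) ^ (n + 1) ∣ E - 1 := by
    have := expand_X_pow_dvd (X_pow_dvd_tailSeries_sub_one V (n + 1)) r hr
    rwa [map_sub, map_one] at this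
  have h1 : (SStar (V.lieSeries r hr) : Ser F G) =
      SStar R * SStar (V.lieSeriesTrunc r hr n) := by
    rw [← SStar_add, sub_add_cancel]
  have h2 : PowerSeries.expand r hr (V.tailSeries 1) * (1 - PowerSeries.monomial r V.cls) = 1 := by
    have := congrArg (PowerSeries.expand r hr) (tailSeries_one_mul V)
    rwa [map_mul, map_sub, map_one, PowerSeries.expand_monomial, mul_one] at this
  have h3 := SStar_lieSeriesTrunc_mul V r hr n
  have h4 : (SStar (V.lieSeries r hr) : Ser F G) * (1 - PowerSeries.monomial r V.cls) * E =
      SStar R := by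
    calc _ = SStar R * ((SStar (V.lieSeriesTrunc r hr n) : Ser F G) * E *
        (1 - PowerSeries.monomial r V.cls)) := by rw [h1]; ring
      _ = SStar R := by rw [h3, h2, mul_one]
  have h5 : (SStar (V.lieSeries r hr) : Ser F G) * (1 - PowerSeries.monomial r V.cls) - 1 =
      (SStar R - 1) - (SStar (V.lieSeries r hr) : Ser F G) * (1 - PowerSeries.monomial r V.cls) *
        (E - 1) := by
    rw [← h4]
    ring
  rw [h5]
  exact dvd_sub hR (Dvd.dvd.mul_left hE _)

theorem SStar_neg_lieSeries [CharZero F] (V : FinMod F G) (r : ℕ) (hr : r ≠ 0) :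
    (SStar (-V.lieSeries r hr) : Ser F G) = 1 - PowerSeries.monomial r V.cls := by
  have h := SStar_neg_mul (V.lieSeries r hr)
  rw [mul_comm, ← SStar_lieSeries_mul V r hr] at h
  exact (PowerSeries.isUnit_of_constantCoeff_eq_one (SStar (V.lieSeries r hr)).2).mul_left_cancel h

/-! ### The Lie module function -/

/-- The element `1 - f` of `1 + tΠ`. -/
noncomputable def oneSub (f : TSer F G) : OneTSer F G :=
  ⟨1 - (f : Ser F G), by
    have : PowerSeries.constantCoeff (f : Ser F G) = 0 := f.2
    rw [map_sub, this, map_one, sub_zero]⟩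

/-- The element `1 - f` of `tΠ`, for `f` in `1 + tΠ`. -/
noncomputable def subOne (f : OneTSer F G) : TSer F G :=
  ⟨1 - (f : Ser F G), by rw [RingHom.mem_ker, map_sub, f.2, map_one, sub_self]⟩

theorem coe_oneSub (f : TSer F G) : (oneSub f : Ser F G) = 1 - (f : Ser F G) := rfl

theorem coe_subOne (f : OneTSer F G) : (subOne f : Ser F G) = 1 - (f : Ser F G) := rfl

/-- The function is `f ↦ -(S*)⁻¹(1 - f)`. Its law for `f + g - fg` comes from `(1 - f)(1 - g) = 1 -
(f + g - fg)`. -/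
theorem exists_isLieModuleFunction [CharZero F] : ∃ L, IsLieModuleFunction F G L := by
  let e : TSer F G ≃ OneTSer F G := Equiv.ofBijective SStar SStar_bijective
  have he : ∀ f, (SStar (e.symm f) : Ser F G) = f := fun f =>
    congrArg Subtype.val (e.apply_symm_apply f)
  have huniq : ∀ f g : TSer F G, (SStar f : Ser F G) = SStar g → f = g := fun f g h =>
    SStar_bijective.1 (Subtype.ext h)
  refine ⟨fun f => -e.symm (oneSub f), fun V r hr => ?_, fun f g => ?_, fun n f hf => ?_⟩
  · rw [neg_eq_iff_eq_neg]
    refine huniq _ _ ?_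
    rw [he, SStar_neg_lieSeries]
    rfl
  · rw [← neg_add, neg_inj]
    refine huniq _ _ ?_
    rw [SStar_add, he, he, he, coe_oneSub, coe_oneSub, coe_oneSub, Submodule.coe_sub,
      Submodule.coe_add, Submodule.coe_smul, smul_eq_mul]
    ring
  · rw [Submodule.coe_neg, dvd_neg, ← X_pow_dvd_SStar_sub_one_iff, he, coe_oneSub, sub_sub_cancel_left,
      dvd_neg]
    exact hf

/-- A Lie module function is determined by `S*`. -/
theorem IsLieModuleFunction.apply_subOne_SStar [CharZero F] {L : TSer F G → TSer F G}
    (hL : IsLieModuleFunction F G L) (f : TSer F G) : L (subOne (SStar f)) = -f := by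
  have hadd : ∀ f g, L (subOne (SStar (f + g))) = L (subOne (SStar f)) + L (subOne (SStar g)) := by
    intro f g
    rw [hL.map_circ]
    congr 1
    refine Subtype.ext ?_
    rw [Submodule.coe_sub, Submodule.coe_add, Submodule.coe_smul, smul_eq_mul, coe_subOne,
      coe_subOne, coe_subOne, SStar_add]
    ring
  -- `δ` measures the failure of the claim. It is additive between rational vector spaces, hence
  -- `ℚ`-linear, and is to be shown zero.
  let δ : TSer F G →ₗ[ℚ] TSer F G :=
    (AddMonoidHom.mk' (fun f => L (subOne (SStar f)) + f) (by
      intro f g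
      rw [hadd]
      abel)).toRatLinearMap
  have hδ : ∀ f, δ f = L (subOne (SStar f)) + f := fun f => rfl
  have hlie : ∀ (V : FinMod F G) (r : ℕ) (hr : r ≠ 0), δ (V.lieSeries r hr) = 0 := by
    intro V r hr
    have h1 : subOne (SStar (-V.lieSeries r hr)) = V.single r hr := by
      refine Subtype.ext ?_
      rw [coe_subOne, SStar_neg_lieSeries, sub_sub_cancel]
      rfl
    rw [← neg_eq_zero, ← map_neg, hδ, h1, hL.map_single, add_neg_cancel]
  have hord : ∀ (n : ℕ) (f : TSer F G), (PowerSeries.X : Ser F G) ^ n ∣ (f : Ser F G) →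
      (PowerSeries.X : Ser F G) ^ n ∣ (δ f : Ser F G) := by
    intro n f hf
    rw [hδ, Submodule.coe_add]
    refine dvd_add (hL.map_order n _ ?_) hf
    rw [coe_subOne, dvd_sub_comm]
    exact (X_pow_dvd_SStar_sub_one_iff f n).2 hf
  -- The kernel of `δ` realizes every leading term: the Lie series with `r = n + 1` begins with `V
  -- t^{n+1}`, and the classes of modules span `Γ`.
  have hlead : ∀ (n : ℕ) (a : Gam F G), ∃ h : TSer F G, δ h = 0 ∧
      (PowerSeries.X : Ser F G) ^ (n + 1) ∣ (h : Ser F G) ∧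
      PowerSeries.coeff (n + 1) (h : Ser F G) = a := by
    intro n a
    have ha : a ∈ Submodule.span ℚ (Set.range (FinMod.cls : FinMod F G → Gam F G)) := by
      rw [span_cls_eq_top]
      trivial
    induction ha using Submodule.span_induction with
    | mem a ha =>
      obtain ⟨V, rfl⟩ := ha
      have hn := n.succ_ne_zero
      refine ⟨V.lieSeries (n + 1) hn, hlie V _ hn, ?_, ?_⟩
      · rw [PowerSeries.X_pow_dvd_iff]
        intro m hm
        rw [FinMod.lieSeries, PowerSeries.coeff_expand]
        split_ifs with h
        · rw [Nat.eq_zero_of_dvd_of_lt h hm, Nat.zero_div, PowerSeries.coeff_mk, if_pos rfl]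
        · rfl
      · rw [FinMod.lieSeries, PowerSeries.coeff_expand, if_pos dvd_rfl, Nat.div_self n.succ_pos,
          PowerSeries.coeff_mk, if_neg one_ne_zero, cls_liePow_one]
    | zero => exact ⟨0, map_zero δ, dvd_zero _, map_zero _⟩
    | add a b _ _ ha hb =>
      obtain ⟨h, h1, h2, h3⟩ := ha
      obtain ⟨k, k1, k2, k3⟩ := hb
      refine ⟨h + k, by rw [map_add, h1, k1, add_zero], ?_, ?_⟩
      · rw [Submodule.coe_add]; exact dvd_add h2 k2
      · rw [Submodule.coe_add, map_add, h3, k3]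
    | smul q a _ ha =>
      obtain ⟨h, h1, h2, h3⟩ := ha
      refine ⟨q • h, by rw [map_smul, h1, smul_zero], ?_, ?_⟩
      · have : ((q • h : TSer F G) : Ser F G) = q • (h : Ser F G) := rfl
        rw [this, Algebra.smul_def]
        exact Dvd.dvd.mul_left h2 _
      · have : ((q • h : TSer F G) : Ser F G) = q • (h : Ser F G) := rfl
        rw [this, ← h3]
        rfl
  -- Subtracting kernel elements removes leading terms one at a time, so `δ f` is a value of `δ` at
  -- series of arbitrarily high order, hence divisible by every power of `t`.
  have hshift : ∀ n, ∃ f' : TSer F G, δ f = δ f' ∧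
      (PowerSeries.X : Ser F G) ^ (n + 1) ∣ (f' : Ser F G) := by
    intro n
    induction n with
    | zero =>
      refine ⟨f, rfl, ?_⟩
      rw [zero_add, pow_one]
      exact PowerSeries.X_dvd_iff.2 f.2
    | succ n ih =>
      obtain ⟨f', h1, h2⟩ := ih
      obtain ⟨h, k1, k2, k3⟩ := hlead n (PowerSeries.coeff (n + 1) (f' : Ser F G))
      refine ⟨f' - h, by rw [map_sub, k1, sub_zero, h1], ?_⟩
      rw [PowerSeries.X_pow_dvd_iff] at h2 k2 ⊢
      intro m hm
      rw [Submodule.coe_sub, map_sub]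
      rcases (Nat.lt_succ_iff.1 hm).eq_or_lt with rfl | hm
      · rw [k3, sub_self]
      · rw [h2 m hm, k2 m hm, sub_zero]
  have hzero : δ f = 0 := by
    refine Subtype.ext (eq_of_forall_X_pow_dvd_sub fun n => ?_)
    obtain ⟨f', h1, h2⟩ := hshift n
    rw [Submodule.coe_zero, sub_zero, h1]
    exact hord n f' ((pow_dvd_pow _ n.le_succ).trans h2)
  exact eq_neg_of_add_eq_zero_left hzero

theorem existsUnique_isLieModuleFunction (F : Type u) [Field F] [CharZero F] (G : Type v)
    [Group G] : ∃! L : TSer F G → TSer F G, IsLieModuleFunction F G L := by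
  obtain ⟨L, hL⟩ := exists_isLieModuleFunction (F := F) (G := G)
  refine ⟨L, hL, fun L' hL' => funext fun g => ?_⟩
  obtain ⟨f, hf⟩ := SStar_bijective.2 (oneSub g)
  have hg : g = subOne (SStar f) := Subtype.ext (by rw [hf, coe_subOne, coe_oneSub, sub_sub_cancel])
  rw [hg, hL.apply_subOne_SStar, hL'.apply_subOne_SStar]

theorem LStar_SStar [CharZero F] (f : TSer F G) : LStar (SStar f) = f := by
  have hL : IsLieModuleFunction F G (lieModuleFunction F G) :=
    Classical.epsilon_spec (existsUnique_isLieModuleFunction F G).exists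
  exact neg_eq_iff_eq_neg.2 (hL.apply_subOne_SStar f)

theorem SStar_LStar [CharZero F] (f : OneTSer F G) : SStar (LStar f) = f := by
  obtain ⟨g, rfl⟩ := SStar_bijective.2 f
  rw [LStar_SStar]

end GreenRingLie

/-- In characteristic `0`, the functions `ψ` and `𝓛` from which `S*` and `L*` are built exist and
are unique, and `L*` and `S*` are mutually inverse. -/
theorem theorem5p4 (F : Type u) [Field F] [CharZero F] (G : Type v) [Group G] :
    (∃! ψ : GreenRingLie.Gam F G →ₗ[ℚ] GreenRingLie.TSer F G, GreenRingLie.IsPsi F G ψ) ∧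
    (∃! L : GreenRingLie.TSer F G → GreenRingLie.TSer F G,
      GreenRingLie.IsLieModuleFunction F G L) ∧
    (∀ f : GreenRingLie.TSer F G, GreenRingLie.LStar (GreenRingLie.SStar f) = f) ∧
    (∀ f : GreenRingLie.OneTSer F G, GreenRingLie.SStar (GreenRingLie.LStar f) = f) :=
  ⟨GreenRingLie.existsUnique_isPsi F G, GreenRingLie.existsUnique_isLieModuleFunction F G,
    GreenRingLie.LStar_SStar, GreenRingLie.SStar_LStar⟩
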